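/- Let $k$ be a perfect field; by a variety over a field $K$ we mean a geometrically integral separated $K$-scheme of finite type. Let $f\colon Y\to X$ be a standard fibration, i.e. a dominant and proper $k$-morphism of varieties over $k$ whose generic fibre is smooth and geometrically integral over the function field of $X$, and assume that $X$ is smooth over $k$. For a scheme $V$ over a field $K$, an Albanese morphism is a $K$-morphism $V\to P$ to a torsor $P$ under an abelian variety $A$ over $K$ which is universal: every $K$-morphism from $V$ to a torsor under an abelian variety over $K$ factors through it in a unique way. We say that $V$ has trivial Albanese variety if it has an Albanese morphism for which the abelian variety $A$ is trivial, i.e. $A=\operatorname{Spec} K$. Assume that $X$ has trivial Albanese variety (over $K=k$), and that there is a point $x\in X$ such that the fibre $Y_x$ is smooth over the residue field $\kappa(x)$ and has trivial Albanese variety (over $K=\kappa(x)$). Then $Y$ has trivial Albanese variety (over $K=k$). -/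

import Mathlib

open CategoryTheory AlgebraicGeometry MonoidalCategory CartesianMonoidalCategory MonObj

universe u

namespace Alb

/-- A variety over a field `K`: a geometrically integral separated `K`-scheme of finite type. -/
class IsVariety {K : Type u} [Field K] (X : Over (Spec (.of K))) : Prop where
  geometricallyIntegral : GeometricallyIntegral X.hom
  isSeparated : IsSeparated X.hom
  locallyOfFiniteType : LocallyOfFiniteType X.hom
  quasiCompact : QuasiCompact X.hom

/-- A variety is an integral scheme; in particular it has a generic point. -/
theorem IsVariety.isIntegral {K : Type u} [Field K] (X : Over (Spec (.of K))) [h : IsVariety X] :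
    IsIntegral X.left :=
  haveI := h.geometricallyIntegral
  GeometricallyIntegral.isIntegral_of_subsingleton X.hom

/-- A standard fibration: a dominant and proper morphism of varieties over `K` whose generic fibre
(a scheme over the residue field of the generic point, i.e. over the function field of `X`)
is smooth and geometrically integral. -/
structure IsStandardFibration {K : Type u} [Field K] {Y X : Over (Spec (.of K))}
    (f : Y ⟶ X) : Prop where
  isVariety_source : IsVariety Y
  isVariety_target : IsVariety X
  isDominant : IsDominant f.left
  isProper : IsProper f.left
  smooth_generic : ∀ ξ : X.left, IsGenericPoint ξ Set.univ →
    Smooth (f.left.fiberToSpecResidueField ξ)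
  geometricallyIntegral_generic : ∀ ξ : X.left, IsGenericPoint ξ Set.univ →
    GeometricallyIntegral (f.left.fiberToSpecResidueField ξ)

/-- An abelian variety over `K`: a proper, smooth, geometrically integral group scheme over `K`. -/
class IsAbelianVariety {K : Type u} [Field K] (A : Over (Spec (.of K))) [GrpObj A] : Prop where
  isProper : IsProper A.hom
  smooth : Smooth A.hom
  geometricallyIntegral : GeometricallyIntegral A.hom

/-- `ρ : A × P ⟶ P` makes `P` a torsor under the `K`-group scheme `A`: it is an action, the map
`(a, p) ↦ (ρ (a, p), p)` is an isomorphism `A × P ≅ P × P`, and `P` is non-empty (so that `P`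
is a faithfully flat `K`-scheme over which the torsor is trivial). -/
structure IsTorsor {K : Type u} [Field K] {A P : Over (Spec (.of K))} [GrpObj A]
    (ρ : A ⊗ P ⟶ P) : Prop where
  one_act : η[A] ▷ P ≫ ρ = (λ_ P).hom
  mul_act : μ[A] ▷ P ≫ ρ = (α_ A A P).hom ≫ A ◁ ρ ≫ ρ
  isIso : IsIso (lift ρ (snd A P))
  nonempty : Nonempty P.left

/-- `a : X ⟶ P` is an Albanese morphism of `X`, with Albanese variety `A`: the scheme `P` is a
torsor (via `ρ`) under the abelian variety `A`, and `a` is universal among the `K`-morphisms from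
`X` to torsors under abelian varieties over `K`. -/
structure IsAlbanese {K : Type u} [Field K] {X A P : Over (Spec (.of K))} [GrpObj A]
    (ρ : A ⊗ P ⟶ P) (a : X ⟶ P) : Prop where
  isAbelianVariety : IsAbelianVariety A
  isTorsor : IsTorsor ρ
  existsUnique_fac : ∀ (B Q : Over (Spec (.of K))) [GrpObj B] [IsAbelianVariety B]
    (σ : B ⊗ Q ⟶ Q), IsTorsor σ → ∀ g : X ⟶ Q, ∃! h : P ⟶ Q, a ≫ h = g

/-- `X` has trivial Albanese variety: it has an Albanese morphism, and the corresponding abelian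
variety `A` is trivial, i.e. its structure morphism `A ⟶ Spec K` is an isomorphism. -/
def HasTrivialAlbanese {K : Type u} [Field K] (X : Over (Spec (.of K))) : Prop :=
  ∃ (A P : Over (Spec (.of K))) (_ : GrpObj A) (ρ : A ⊗ P ⟶ P) (a : X ⟶ P),
    IsAlbanese ρ a ∧ IsIso A.hom

/-- The fibre of a morphism of schemes `f` at `x`, as a scheme over the residue field at `x`. -/
noncomputable def fibre {Y X : Scheme.{u}} (f : Y ⟶ X) (x : X) :
    Over (Spec (.of (X.residueField x))) :=
  Over.mk (f.fiberToSpecResidueField x)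

end Alb

/-! Let `g` map `Y` to a torsor `Q` under an abelian variety `B`. It suffices to factor `g` through
`f`: the Albanese morphism of `X` composed with `f` is then universal for `Y`, with uniqueness
because `f` is dominant and `Q` separated.

After base change to `κ(x)`, triviality of the Albanese variety of the fibre over `x` forces `g` to
collapse that fibre to one point, which lies in an affine open `V` of `Q`
(`apply_eq_of_hasTrivialAlbanese_fibre`). As `f` is closed, the points of `X` whose whole fibre goes
into `V` form an open set; it contains `x`, hence the generic point `ξ`. The generic fibre is proper
and geometrically integral, so its global functions are the constants `κ(ξ)`, and its map to the
affine `V` factors through `Spec κ(ξ)`. The resulting rational map from `X` to `Q` extends to the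
smooth `X` by Weil's theorem (`exists_fromSpecStalk_comp_eq`). Its composite with `f` is `g`,
because the two agree on the dense generic fibre (`IsStandardFibration.exists_comp_eq`).

Most of the work is Weil's theorem. On an affine chart `Spec A` étale over affine space, a rational
map `φ` is extended to each prime `p` by induction on the height. If `A_p` is a valuation ring, the
valuative criterion applies. Otherwise consider `(u, v) ↦ φ(u) - φ(v)` on the product. It sends the
diagonal points of the primes `q < p` to the identity of `B`, so near them it is a family of
functions on an affine neighbourhood of the identity. A Hartogs argument along the diagonal makes
these functions regular at the diagonal point of `p` too (`exists_mul_eq_of_forall_lt`). Then `φ(u)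
= (φ(u) - φ(v)) + φ(v)` with `v` generic extends `φ` over a faithfully flat extension of `A_p`, and
the extension descends (`ExtendsAlong.of_diffFrac`). -/

namespace Alb

open IsLocalRing

/-! ### Extending fractions over a local ring: depth two and regular sequences. -/

section Algebra

variable {S : Type*} [CommRing S]

/-- `J.ExtendsFrom W`: a fraction `a / b` of the ring `S ⧸ J` that is regular at all the points of
`W` is regular everywhere. -/
def ExtendsFrom (W : Set (Ideal S)) (J : Ideal S) : Prop :=
  ∀ a b : S, b ∉ J → (∀ P ∈ W, ∃ c ∉ P, c * a ∈ Ideal.span {b} ⊔ J) → a ∈ Ideal.span {b} ⊔ J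

theorem mem_span_singleton_sup {J : Ideal S} {a b : S} :
    a ∈ Ideal.span {b} ⊔ J ↔ ∃ s, a - b * s ∈ J := by
  rw [Ideal.mem_span_singleton_sup]
  constructor
  · rintro ⟨s, j, hj, rfl⟩
    exact ⟨s, by convert hj using 1; ring⟩
  · rintro ⟨s, hs⟩
    exact ⟨s, _, hs, by ring⟩

/-- Krull's intersection theorem in the local ring `S ⧸ J`. -/
theorem mem_of_forall_mem_pow_sup [IsNoetherianRing S] [IsLocalRing S] {J : Ideal S} {t : S}
    (ht : t ∈ maximalIdeal S) {a : S} (h : ∀ n, a ∈ Ideal.span {t ^ n} ⊔ J) : a ∈ J := by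
  by_cases hJ : J = ⊤
  · simp [hJ]
  have : Nontrivial (S ⧸ J) := Ideal.Quotient.nontrivial_iff.mpr hJ
  have : IsLocalRing (S ⧸ J) := .of_surjective' (Ideal.Quotient.mk J) Ideal.Quotient.mk_surjective
  rw [← Ideal.Quotient.eq_zero_iff_mem]
  have hne : Ideal.span {Ideal.Quotient.mk J t} ≠ ⊤ := by
    rw [Ne, Ideal.span_singleton_eq_top]
    intro hu
    have := (IsLocalRing.surjective_units_map_of_local_ringHom (Ideal.Quotient.mk J)
      Ideal.Quotient.mk_surjective
      (.of_surjective _ Ideal.Quotient.mk_surjective)) hu.unit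
    obtain ⟨v, hv⟩ := this
    have h1 : t - v ∈ J := by
      rw [← Ideal.Quotient.eq]
      simpa using congr(($hv).1).symm
    have h2 : (v : S) ∈ maximalIdeal S := by
      simpa using Ideal.sub_mem _ ht (le_maximalIdeal hJ h1)
    exact h2 v.isUnit
  have key := Ideal.iInf_pow_eq_bot_of_isLocalRing _ hne
  rw [← Ideal.mem_bot, ← key, Ideal.mem_iInf]
  intro n
  obtain ⟨s, hs⟩ := mem_span_singleton_sup.mp (h n)
  rw [Ideal.span_singleton_pow, Ideal.mem_span_singleton]
  refine ⟨Ideal.Quotient.mk J s, ?_⟩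
  rw [← map_pow, ← map_mul]
  exact Ideal.Quotient.eq.mpr hs

theorem mul_mem_pow_sup_cancel {J : Ideal S} {t y : S}
    (ht : ∀ x, t * x ∈ J → x ∈ J) (hy : ∀ x, y * x ∈ Ideal.span {t} ⊔ J → x ∈ Ideal.span {t} ⊔ J)
    (n : ℕ) {x : S} (hx : y * x ∈ Ideal.span {t ^ n} ⊔ J) : x ∈ Ideal.span {t ^ n} ⊔ J := by
  induction n generalizing x with
  | zero => simp
  | succ n ih =>
    obtain ⟨s, hs⟩ := mem_span_singleton_sup.mp hx
    obtain ⟨x', hx'⟩ := mem_span_singleton_sup.mp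
      (hy x (mem_span_singleton_sup.mpr ⟨t ^ n * s, by convert hs using 1; ring⟩))
    have h1 : t * (y * x' - t ^ n * s) ∈ J := by
      have := J.sub_mem hs (J.mul_mem_left y hx')
      convert this using 1; ring
    obtain ⟨z, hz⟩ := mem_span_singleton_sup.mp
      (ih (mem_span_singleton_sup.mpr ⟨s, ht _ h1⟩))
    refine mem_span_singleton_sup.mpr ⟨z, ?_⟩
    have := J.add_mem hx' (J.mul_mem_left t hz)
    convert this using 1; ring

theorem pow_mul_mem_sup_cancel {J : Ideal S} {y : S}
    (hy : ∀ x, y * x ∈ J → x ∈ J) (n : ℕ) {x : S} (hx : y ^ n * x ∈ J) : x ∈ J := by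
  induction n with
  | zero => simpa using hx
  | succ n ih => exact ih (hy _ (by convert hx using 1; ring))

/-- By Krull's intersection theorem, an element outside `J` is `t ^ n * a'` modulo `J` with `a' ∉
(t) + J`. In a product of two such elements the power of `t` cancels, and primality of `(t) + J`
applies. -/
theorem isPrime_of_regular [IsNoetherianRing S] [IsLocalRing S] {J : Ideal S} {t : S}
    (ht : t ∈ maximalIdeal S) (hreg : ∀ x, t * x ∈ J → x ∈ J)
    (hprime : (Ideal.span {t} ⊔ J).IsPrime) : J.IsPrime := by
  have key : ∀ a ∉ J, ∃ n a', a - t ^ n * a' ∈ J ∧ a' ∉ Ideal.span {t} ⊔ J := by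
    intro a ha
    by_contra! hcon
    refine ha (mem_of_forall_mem_pow_sup ht fun n ↦ ?_)
    induction n with
    | zero => simp
    | succ n ih =>
      obtain ⟨s, hs⟩ := mem_span_singleton_sup.mp ih
      obtain ⟨s', hs'⟩ := mem_span_singleton_sup.mp (hcon n s hs)
      refine mem_span_singleton_sup.mpr ⟨s', ?_⟩
      convert J.add_mem hs (J.mul_mem_left (t ^ n) hs') using 1; ring
  refine ⟨fun h ↦ hprime.ne_top (by simp [h]), fun {a b} hab ↦ ?_⟩
  by_contra! hcon
  obtain ⟨n, a', ha, ha'⟩ := key a hcon.1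
  obtain ⟨m, b', hb, hb'⟩ := key b hcon.2
  have : t ^ (n + m) * (a' * b') ∈ J := by
    have h1 := J.sub_mem hab (J.add_mem (J.mul_mem_right b ha) (J.mul_mem_left (t ^ n * a') hb))
    convert h1 using 1; ring
  have := pow_mul_mem_sup_cancel hreg _ this
  exact (hprime.mem_or_mem (Ideal.mem_sup_right this)).elim ha' hb'

/-- The quotient `a / b` is expanded in powers of `t`: `H` supplies one coefficient at a time modulo
`t`, the remainder satisfies the same local conditions, and Krull's intersection theorem concludes.
-/
theorem ExtendsFrom.of_regular [IsNoetherianRing S] [IsLocalRing S] {W : Set (Ideal S)}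
    {J : Ideal S} {t : S}
    (ht : t ∈ maximalIdeal S) (hreg : ∀ x, t * x ∈ J → x ∈ J)
    (hprime : (Ideal.span {t} ⊔ J).IsPrime) (hex : ∃ P ∈ W, Ideal.span {t} ⊔ J ≤ P)
    (H : ExtendsFrom W (Ideal.span {t} ⊔ J)) : ExtendsFrom W J := by
  have hJ := isPrime_of_regular ht hreg hprime
  -- A denominator in `(t) + J` is traded for one outside it, namely the one that the fraction has
  -- at a prime of `W` containing `(t) + J`.
  suffices main : ∀ a b : S, b ∉ Ideal.span {t} ⊔ J →
      (∀ P ∈ W, ∃ c ∉ P, c * a ∈ Ideal.span {b} ⊔ J) → a ∈ Ideal.span {b} ⊔ J by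
    intro a b hb hab
    obtain ⟨P₀, hP₀, hle⟩ := hex
    obtain ⟨c, hc, hca⟩ := hab P₀ hP₀
    obtain ⟨d, hd⟩ := mem_span_singleton_sup.mp hca
    have hcJ : c ∉ Ideal.span {t} ⊔ J := fun h ↦ hc (hle h)
    have := main d c hcJ fun P hP ↦ by
      obtain ⟨c', hc', hca'⟩ := hab P hP
      obtain ⟨d', hd'⟩ := mem_span_singleton_sup.mp hca'
      refine ⟨c', hc', mem_span_singleton_sup.mpr ⟨d', ?_⟩⟩
      refine (hJ.mem_or_mem (x := b) ?_).resolve_left hb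
      have := J.sub_mem (J.mul_mem_left c hd') (J.mul_mem_left c' hd)
      convert this using 1; ring
    obtain ⟨e, he⟩ := mem_span_singleton_sup.mp this
    refine mem_span_singleton_sup.mpr ⟨e, ?_⟩
    refine (hJ.mem_or_mem (x := c) ?_).resolve_left fun h ↦ hcJ (Ideal.mem_sup_right h)
    have := J.add_mem hd (J.mul_mem_left b he)
    convert this using 1; ring
  intro a b hb hab
  have step : ∀ n, ∃ s a', a - (b * s + t ^ n * a') ∈ J ∧
      ∀ P ∈ W, ∃ c ∉ P, c * a' ∈ Ideal.span {b} ⊔ J := by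
    intro n
    induction n with
    | zero => exact ⟨0, a, by simp, hab⟩
    | succ n ih =>
      obtain ⟨s, a', ha', hloc⟩ := ih
      have h1 := H a' b hb fun P hP ↦ by
        obtain ⟨c, hc, hca⟩ := hloc P hP
        exact ⟨c, hc, sup_le_sup_left (le_sup_right (a := Ideal.span {t})) _ hca⟩
      obtain ⟨s', hs'⟩ := mem_span_singleton_sup.mp h1
      obtain ⟨a'', ha''⟩ := mem_span_singleton_sup.mp hs'
      refine ⟨s + t ^ n * s', a'', ?_, fun P hP ↦ ?_⟩
      · convert J.add_mem ha' (J.mul_mem_left (t ^ n) ha'') using 1; ring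
      · obtain ⟨c, hc, hca⟩ := hloc P hP
        obtain ⟨d, hd⟩ := mem_span_singleton_sup.mp hca
        refine ⟨c, hc, ?_⟩
        -- The new remainder `a''` over `b` is still regular at `P`: modulo `J`, `t` divides `b * (d
        -- - c * s')`, hence `d - c * s'`, and then `t` cancels.
        have h2 : t * (c * a'') - b * (d - c * s') ∈ J := by
          convert J.sub_mem hd (J.mul_mem_left c ha'') using 1; ring
        have h3 : b * (d - c * s') ∈ Ideal.span {t} ⊔ J := by
          refine mem_span_singleton_sup.mpr ⟨c * a'', ?_⟩
          convert J.neg_mem h2 using 1; ring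
        obtain ⟨d', hd'⟩ := mem_span_singleton_sup.mp ((hprime.mem_or_mem h3).resolve_left hb)
        refine mem_span_singleton_sup.mpr ⟨d', hreg _ ?_⟩
        convert J.add_mem h2 (J.mul_mem_left b hd') using 1; ring
  refine mem_of_forall_mem_pow_sup ht fun n ↦ ?_
  obtain ⟨s, a', h, -⟩ := step n
  refine mem_span_singleton_sup.mpr ⟨a', mem_span_singleton_sup.mpr ⟨s, ?_⟩⟩
  convert h using 1; ring

/-- The ideal `C` of denominators of `a / b` lies in no prime except possibly the maximal one, so it
contains powers of `p` and of `y`. Modulo `I` this gives `a / b = c / p ^ n = d / y ^ m`; since `p`,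
`y` is a regular sequence, `p ^ n` divides `c`. -/
theorem ExtendsFrom.of_depth [IsLocalRing S] {I : Ideal S} (hI : I.IsPrime) {p y : S}
    (hp : p ∈ maximalIdeal S) (hy : y ∈ maximalIdeal S) (hpreg : ∀ x, p * x ∈ I → x ∈ I)
    (hyreg : ∀ x, y * x ∈ Ideal.span {p} ⊔ I → x ∈ Ideal.span {p} ⊔ I) :
    ExtendsFrom {P | P.IsPrime ∧ I ≤ P ∧ P ≠ maximalIdeal S} I := by
  intro a b hb hab
  let C : Ideal S := (Ideal.span {b} ⊔ I).colon {a}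
  have hC : ∀ {c}, c ∈ C ↔ c * a ∈ Ideal.span {b} ⊔ I := by
    intro c; simp [C, Submodule.mem_colon_singleton]
  have hrad : maximalIdeal S ≤ C.radical := by
    rw [Ideal.radical_eq_sInf]
    refine le_sInf fun P ⟨hCP, hP⟩ ↦ ?_
    by_contra hne
    have hPm : P ≠ maximalIdeal S := fun h ↦ hne h.ge
    have hIP : I ≤ P := fun i hi ↦ hCP (hC.mpr (Ideal.mem_sup_right (I.mul_mem_right _ hi)))
    obtain ⟨c, hc, hca⟩ := hab P ⟨hP, hIP, hPm⟩
    exact hc (hCP (hC.mpr hca))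
  obtain ⟨n, hn⟩ := hrad hp
  obtain ⟨m, hm⟩ := hrad hy
  obtain ⟨c, hc⟩ := mem_span_singleton_sup.mp (hC.mp hn)
  obtain ⟨d, hd⟩ := mem_span_singleton_sup.mp (hC.mp hm)
  have h1 : b * (y ^ m * c - p ^ n * d) ∈ I := by
    convert I.sub_mem (I.mul_mem_left (p ^ n) hd) (I.mul_mem_left (y ^ m) hc) using 1; ring
  have h2 : y ^ m * c ∈ Ideal.span {p ^ n} ⊔ I :=
    mem_span_singleton_sup.mpr ⟨d, (hI.mem_or_mem h1).resolve_left hb⟩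
  have h3 : c ∈ Ideal.span {p ^ n} ⊔ I :=
    pow_mul_mem_sup_cancel (fun x ↦ mul_mem_pow_sup_cancel hpreg hyreg n) m h2
  obtain ⟨c', hc'⟩ := mem_span_singleton_sup.mp h3
  refine mem_span_singleton_sup.mpr ⟨c', pow_mul_mem_sup_cancel hpreg n ?_⟩
  convert I.add_mem hc (I.mul_mem_left b hc') using 1; ring

/-- Fractions extend along a regular sequence `t₀, …, tₙ₋₁` from the quotient to the ring. -/
theorem ExtendsFrom.of_regularSequence [IsNoetherianRing S] [IsLocalRing S] {W : Set (Ideal S)}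
    {n : ℕ} (J : ℕ → Ideal S) (t : ℕ → S)
    (hJ : ∀ i < n, J (i + 1) = Ideal.span {t i} ⊔ J i)
    (ht : ∀ i < n, t i ∈ maximalIdeal S) (hreg : ∀ i < n, ∀ x, t i * x ∈ J i → x ∈ J i)
    (hprime : (J n).IsPrime) (hex : ∃ P ∈ W, J n ≤ P) (H : ExtendsFrom W (J n)) :
    ExtendsFrom W (J 0) := by
  suffices ∀ i ≤ n, (J i).IsPrime ∧ (∃ P ∈ W, J i ≤ P) ∧ ExtendsFrom W (J i) from
    (this 0 n.zero_le).2.2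
  intro i hi
  induction hi using Nat.decreasingInduction with
  | self => exact ⟨hprime, hex, H⟩
  | of_succ i hi ih =>
    rw [hJ i hi] at ih
    obtain ⟨h1, ⟨P, hP, hle⟩, h3⟩ := ih
    exact ⟨isPrime_of_regular (ht i hi) (hreg i hi) h1, ⟨P, hP, le_sup_right.trans hle⟩,
      h3.of_regular (ht i hi) (hreg i hi) h1 ⟨P, hP, hle⟩⟩

end Algebra

/-! ### Regular sequences and the equations of the diagonal in étale coordinates. -/

section Regular

open scoped TensorProduct

theorem mem_map_of_flat {R S : Type*} [CommRing R] [CommRing S] {f : R →+* S} (hf : f.Flat)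
    {J : Ideal R} {t : R} (h : ∀ x, t * x ∈ J → x ∈ J) {x : S} (hx : f t * x ∈ J.map f) :
    x ∈ J.map f := by
  algebraize [f]
  have h1 : IsSMulRegular (R ⧸ J) t := by
    rw [isSMulRegular_iff_right_eq_zero_of_smul]
    intro m hm
    obtain ⟨m, rfl⟩ := Ideal.Quotient.mk_surjective m
    rw [Ideal.Quotient.eq_zero_iff_mem]
    exact h m (Ideal.Quotient.eq_zero_iff_mem.mp hm)
  have h2 : IsSMulRegular (S ⊗[R] (R ⧸ J)) (algebraMap R S t) :=
    h1.of_flat_of_isBaseChange (TensorProduct.isBaseChange R (R ⧸ J) S)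
  let e := TensorProduct.tensorQuotEquivQuotSMul S J
  have hJ : ∀ y : S, y ∈ J.map f ↔ (Submodule.Quotient.mk y : S ⧸ (J • ⊤ : Submodule R S)) = 0 := by
    intro y
    rw [Submodule.Quotient.mk_eq_zero, Ideal.smul_top_eq_map]
    rfl
  rw [hJ] at hx ⊢
  have h3 : algebraMap R S t • e.symm (Submodule.Quotient.mk x) = 0 := by
    rw [algebraMap_smul, ← map_smul, ← Submodule.Quotient.mk_smul, Algebra.smul_def t x]
    exact (congrArg e.symm hx).trans (map_zero _)
  exact e.symm.injective ((h2 (h3.trans (smul_zero _).symm)).trans (map_zero _).symm)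

/-- A finite sequence of ring elements each of which is a non-zero-divisor modulo the previous
ones. -/
def IsRegSeq {R : Type*} [CommRing R] {n : ℕ} (t : Fin n → R) : Prop :=
  ∀ j x, t j * x ∈ Ideal.span (t '' Set.Iio j) → x ∈ Ideal.span (t '' Set.Iio j)

theorem IsRegSeq.map {R S : Type*} [CommRing R] [CommRing S] {f : R →+* S} (hf : f.Flat)
    {n : ℕ} {t : Fin n → R} (ht : IsRegSeq t) : IsRegSeq (f ∘ t) := by
  intro j x hx
  rw [Set.image_comp, ← Ideal.map_span] at hx ⊢
  exact mem_map_of_flat hf (ht j) hx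

theorem isRegSeq_X (R : Type*) [CommRing R] (n : ℕ) :
    IsRegSeq (MvPolynomial.X : Fin n → MvPolynomial (Fin n) R) := by
  intro j x hx
  rw [MvPolynomial.mem_ideal_span_X_image] at hx ⊢
  intro m hm
  obtain ⟨i, hi, h⟩ := hx (Finsupp.single j 1 + m) (by
    rw [MvPolynomial.mem_support_iff] at hm ⊢
    rwa [MvPolynomial.coeff_X_mul])
  refine ⟨i, hi, ?_⟩
  have : i ≠ j := ne_of_lt hi
  simpa [Finsupp.single_apply, this.symm] using h

/-- A translation of the variables carries the sequence of the `X i` to this one. -/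
theorem isRegSeq_X_sub_C {R : Type*} [CommRing R] {n : ℕ} (a : Fin n → R) :
    IsRegSeq (fun i ↦ MvPolynomial.X i - MvPolynomial.C (a i)) := by
  let σ : MvPolynomial (Fin n) R →ₐ[R] MvPolynomial (Fin n) R :=
    MvPolynomial.aeval fun i ↦ MvPolynomial.X i - MvPolynomial.C (a i)
  let τ : MvPolynomial (Fin n) R →ₐ[R] MvPolynomial (Fin n) R :=
    MvPolynomial.aeval fun i ↦ MvPolynomial.X i + MvPolynomial.C (a i)
  let e : MvPolynomial (Fin n) R ≃ₐ[R] MvPolynomial (Fin n) R :=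
    AlgEquiv.ofAlgHom σ τ (by ext i; simp [σ, τ, MvPolynomial.algebraMap_eq])
      (by ext i; simp [σ, τ])
  have := (isRegSeq_X R n).map (f := e.toAlgHom.toRingHom) (.of_bijective e.bijective)
  convert this using 1
  ext1 i
  simp [e, σ]

/-- The differences `x ⊗ 1 - 1 ⊗ x` of the two pullbacks of étale coordinates. -/
noncomputable def coordDiff {k A : Type*} [Field k] [CommRing A] [Algebra k A] {n : ℕ}
    (g : MvPolynomial (Fin n) k →ₐ[k] A) (i : Fin n) : A ⊗[k] A :=
  1 ⊗ₜ g (.X i) - g (.X i) ⊗ₜ 1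

/-- The map `A[X] ≅ A ⊗ k[X] → A ⊗ A` is flat because `g` is, and it sends `X i - g (X i)` to
`coordDiff g i`. -/
theorem isRegSeq_coordDiff {k A : Type*} [Field k] [CommRing A] [Algebra k A] {n : ℕ}
    (g : MvPolynomial (Fin n) k →ₐ[k] A) (hg : g.toRingHom.Flat) :
    IsRegSeq (coordDiff g) := by
  let e := (MvPolynomial.algebraTensorAlgEquiv (σ := Fin n) k A).symm
  let F := (Algebra.TensorProduct.lTensor (S := A) A g).toRingHom.comp e.toAlgHom.toRingHom
  have hF : F.Flat := RingHom.Flat.comp (.of_bijective e.bijective) (RingHom.Flat.lTensor (S := A) A hg)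
  convert (isRegSeq_X_sub_C (fun i ↦ g (.X i))).map hF using 1
  ext1 i
  have hC : e (MvPolynomial.C (g (.X i))) = g (.X i) ⊗ₜ 1 := e.commutes _
  have hX : e (MvPolynomial.X i) = 1 ⊗ₜ .X i := MvPolynomial.algebraTensorAlgEquiv_symm_X ..
  change _ = Algebra.TensorProduct.lTensor A g (e (MvPolynomial.X i - MvPolynomial.C (g (.X i))))
  rw [map_sub, map_sub, hC, hX]
  simp [coordDiff]

theorem tmul_sub_tmul_mem_span_coordDiff {k A : Type*} [Field k] [CommRing A] [Algebra k A] {n : ℕ}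
    (g : MvPolynomial (Fin n) k →ₐ[k] A) (p : MvPolynomial (Fin n) k) :
    1 ⊗ₜ g p - g p ⊗ₜ 1 ∈ Ideal.span (Set.range (coordDiff g)) := by
  let I := Ideal.span (Set.range (coordDiff g))
  let q := Ideal.Quotient.mkₐ k I
  have : q.comp (Algebra.TensorProduct.includeRight.comp g) =
      q.comp (Algebra.TensorProduct.includeLeft.comp g) := by
    ext i
    exact Ideal.Quotient.eq.mpr (Ideal.subset_span ⟨i, rfl⟩)
  exact Ideal.Quotient.eq.mp congr($this p)

/-- Let `P` be the polynomial ring. Since `A` is unramified over `P`, the ideal of the diagonal in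
`A ⊗[P] A` is killed by an element with product `1`; `e` lifts it. The kernel of `A ⊗[k] A → A ⊗[P]
A` lies in the span of the coordinate differences, so these generate the ideal of the diagonal
wherever `e` is invertible. -/
theorem exists_mul_mem_span_coordDiff {k A : Type*} [Field k] [CommRing A] [Algebra k A] {n : ℕ}
    (g : MvPolynomial (Fin n) k →ₐ[k] A) (hg : g.toRingHom.Etale) :
    ∃ e : A ⊗[k] A, Algebra.TensorProduct.lmul' k e = 1 ∧
      ∀ z, Algebra.TensorProduct.lmul' (S := A) k z = 0 →
        z * e ∈ Ideal.span (Set.range (coordDiff g)) := by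
  algebraize [g.toRingHom]
  let P := MvPolynomial (Fin n) k
  have : IsScalarTower k P A := .of_algebraMap_eq' g.comp_algebraMap.symm
  let q := Algebra.TensorProduct.mapOfCompatibleSMul P k k A A
  have hqs : Function.Surjective q := Algebra.TensorProduct.mapOfCompatibleSMul_surjective P k k A A
  obtain ⟨e, he⟩ := hqs (Algebra.FormallyUnramified.elem P A)
  have hmul (z) : Algebra.TensorProduct.lmul' (S := A) P (q z) =
      Algebra.TensorProduct.lmul' (S := A) k z := by
    have : ((Algebra.TensorProduct.lmul' (S := A) P).restrictScalars k).comp q =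
      Algebra.TensorProduct.lmul' (S := A) k := by ext <;> simp [q]
    exact congr($this z)
  have hker : ∀ z, q z = 0 → z ∈ Ideal.span (Set.range (coordDiff g)) := by
    intro z hz
    have hz : z ∈ LinearMap.ker (TensorProduct.mapOfCompatibleSMul P k P A A) := hz
    rw [TensorProduct.AlgebraTensorModule.ker_mapOfCompatibleSMul] at hz
    refine Submodule.span_induction ?_ (zero_mem _) (fun _ _ _ _ ↦ add_mem) ?_ hz
    · rintro _ ⟨p, a, b, rfl⟩
      have := Ideal.mul_mem_left _ (-(a ⊗ₜ[k] b)) (tmul_sub_tmul_mem_span_coordDiff g p)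
      convert this using 1
      have hp : algebraMap P A p = g p := rfl
      simp only [Algebra.smul_def, mul_sub, neg_mul, Algebra.TensorProduct.tmul_mul_tmul,
        _root_.mul_one, hp, _root_.mul_comm (g p)]
      abel
    · intro p x _ hx
      rw [Algebra.smul_def]
      exact Ideal.mul_mem_left _ _ hx
  refine ⟨e, by rw [← hmul, he, Algebra.FormallyUnramified.lmul_elem], fun z hz ↦ hker _ ?_⟩
  rw [map_mul, he]
  have hz' : q z ∈ KaehlerDifferential.ideal P A := by
    rw [RingHom.mem_ker]; exact (hmul z).trans hz
  rw [← KaehlerDifferential.span_range_eq_ideal] at hz'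
  refine Submodule.span_induction (p := fun x _ ↦ x * Algebra.FormallyUnramified.elem P A = 0)
    ?_ (by simp) (fun _ _ _ _ h1 h2 ↦ by simp [add_mul, h1, h2])
    (fun a _ _ h ↦ by rw [smul_eq_mul, _root_.mul_assoc, h, mul_zero]) hz'
  rintro _ ⟨s, rfl⟩
  exact Algebra.FormallyUnramified.one_tmul_sub_tmul_one_mul_elem s

end Regular

/-! ### Hartogs extension along the diagonal. -/

section Extension

open scoped TensorProduct
open IsLocalRing

theorem ExtendsFrom.of_isRegSeq {S : Type*} [CommRing S] [IsNoetherianRing S] [IsLocalRing S]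
    {W : Set (Ideal S)} {n : ℕ} {t : Fin n → S} (ht : IsRegSeq t)
    (htm : ∀ i, t i ∈ maximalIdeal S) (hprime : (Ideal.span (Set.range t)).IsPrime)
    (hex : ∃ P ∈ W, Ideal.span (Set.range t) ≤ P) (H : ExtendsFrom W (Ideal.span (Set.range t))) :
    ExtendsFrom W ⊥ := by
  let J (j : ℕ) : Ideal S := Ideal.span (t '' {i | i.val < j})
  have hn : J n = Ideal.span (Set.range t) := by
    have : {i : Fin n | i.val < n} = Set.univ := by ext; simp
    simp only [J, this, Set.image_univ]
  have h0 : J 0 = ⊥ := by simp [J]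
  rw [← hn] at hprime hex H
  rw [← h0]
  refine H.of_regularSequence J (fun i ↦ if h : i < n then t ⟨i, h⟩ else 0) (fun i hi ↦ ?_)
    (fun i hi ↦ by simpa [hi] using htm _) (fun i hi x hx ↦ ?_) hprime hex
  · have : {j : Fin n | j.val < i + 1} = insert ⟨i, hi⟩ {j | j.val < i} := by
      ext j
      simp only [Set.mem_ofPred_eq, Set.mem_insert_iff, Fin.ext_iff]
      omega
    simp only [J, this, Set.image_insert_eq, hi, dif_pos, Ideal.span_insert]
  · have : {j : Fin n | j.val < i} = Set.Iio ⟨i, hi⟩ := by ext j; simp [Fin.lt_def]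
    simp only [J, this, hi, dif_pos] at hx ⊢
    exact ht _ _ hx

/-- The prime of `A ⊗ A` corresponding to a prime of `A` via the diagonal. -/
abbrev diagPrime (k : Type*) {A : Type*} [Field k] [CommRing A] [Algebra k A] (p : Ideal A) :
    Ideal (A ⊗[k] A) :=
  p.comap (Algebra.TensorProduct.lmul' (S := A) k)

variable {k A : Type*} [Field k] [CommRing A] [IsDomain A] [Algebra k A] {n : ℕ}
    (g : MvPolynomial (Fin n) k →ₐ[k] A) (hg : g.toRingHom.Etale)

omit [IsDomain A] in
include hg in
theorem etale_flat : g.toRingHom.Flat := by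
  algebraize [g.toRingHom]
  have : Algebra.Smooth (MvPolynomial (Fin n) k) A := inferInstance
  exact inferInstanceAs (Module.Flat _ _)

include hg in
/-- A rational function on `Spec (A ⊗ A)` that is regular at all the proper generalizations on the
diagonal of a point of the diagonal is regular at that point, provided that the local ring
of `A` at the point has depth at least two. -/
theorem exists_mul_eq_of_forall_lt [IsDomain (A ⊗[k] A)] [IsNoetherianRing (A ⊗[k] A)]
    (p : Ideal A) [p.IsPrime]
    {π y : MvPolynomial (Fin n) k} (hπ : Prime π) (hπp : g π ∈ p) (hyp : g y ∈ p) (hπy : ¬ π ∣ y)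
    {F : Type*} [Field F] [Algebra (A ⊗[k] A) F] [IsFractionRing (A ⊗[k] A) F] (f : F)
    (H : ∀ q : Ideal A, q.IsPrime → q < p → ∃ a b : A ⊗[k] A, b ∉ diagPrime k q ∧
      algebraMap _ F b * f = algebraMap _ F a) :
    ∃ a b : A ⊗[k] A, b ∉ diagPrime k p ∧ algebraMap _ F b * f = algebraMap _ F a := by
  let T := A ⊗[k] A
  let m : T →+* A := (Algebra.TensorProduct.lmul' (S := A) k).toRingHom
  let δ : Ideal T := p.comap m
  let S := Localization.AtPrime δ
  let R := Localization.AtPrime p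
  have hflat := etale_flat g hg
  have : IsNoetherianRing S := IsLocalization.isNoetherianRing δ.primeCompl S inferInstance
  have hTS : Function.Injective (algebraMap T S) :=
    IsLocalization.injective S δ.primeCompl_le_nonZeroDivisors
  have hAR : Function.Injective (algebraMap A R) :=
    IsLocalization.injective R p.primeCompl_le_nonZeroDivisors
  let φ : S →+* R := Localization.localRingHom δ p m rfl
  have hφ (z : T) : φ (algebraMap T S z) = algebraMap A R (m z) :=
    Localization.localRingHom_to_map _ _ _ _ _
  have hm (a : A) : m (a ⊗ₜ 1) = a :=
    (Algebra.TensorProduct.lmul'_apply_tmul a 1).trans (_root_.mul_one a)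
  have hm' (a : A) : m (1 ⊗ₜ a) = a :=
    (Algebra.TensorProduct.lmul'_apply_tmul 1 a).trans (_root_.one_mul a)
  have hφs : Function.Surjective φ := by
    intro r
    obtain ⟨a, s, rfl⟩ := IsLocalization.exists_mk'_eq p.primeCompl r
    have hs : s.1 ⊗ₜ 1 ∈ δ.primeCompl := fun h ↦ s.2 (by rw [← hm s.1]; exact h)
    refine ⟨IsLocalization.mk' S (a ⊗ₜ 1) (⟨s.1 ⊗ₜ 1, hs⟩ : δ.primeCompl), ?_⟩
    rw [IsLocalization.eq_mk'_iff_mul_eq]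
    have := congrArg φ (IsLocalization.mk'_spec S (a ⊗ₜ[k] (1 : A))
      (⟨s.1 ⊗ₜ 1, hs⟩ : δ.primeCompl))
    rwa [map_mul, hφ, hφ, hm, hm] at this
  let t : Fin n → S := algebraMap T S ∘ coordDiff g
  have htreg : IsRegSeq t := (isRegSeq_coordDiff g hflat).map
    (RingHom.flat_algebraMap_iff.mpr (IsLocalization.flat S δ.primeCompl))
  -- As `e` equals `1` on the diagonal, it is a unit in `S`, so the coordinate differences generate
  -- the full ideal of the diagonal in `S`.
  have hspan : Ideal.span (Set.range t) = RingHom.ker φ := by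
    apply le_antisymm
    · rw [Ideal.span_le]
      rintro _ ⟨i, rfl⟩
      change φ (algebraMap T S (coordDiff g i)) = 0
      rw [hφ, coordDiff, map_sub, hm, hm', sub_self, map_zero]
    · intro z hz
      obtain ⟨a, s, rfl⟩ := IsLocalization.exists_mk'_eq δ.primeCompl z
      have h0 : m a = 0 := by
        have := congrArg φ (IsLocalization.mk'_spec S a s)
        rw [map_mul, RingHom.mem_ker.mp hz, zero_mul, hφ] at this
        exact hAR (this.symm.trans (map_zero _).symm)
      obtain ⟨e, he, hes⟩ := exists_mul_mem_span_coordDiff g hg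
      have h1 := Ideal.mem_map_of_mem (algebraMap T S) (hes a h0)
      rw [Ideal.map_span, ← Set.range_comp, map_mul] at h1
      have hu : IsUnit (algebraMap T S e) := by
        refine IsLocalization.map_units S (⟨e, fun h ↦ ?_⟩ : δ.primeCompl)
        refine (inferInstance : p.IsPrime).ne_top ((Ideal.eq_top_iff_one _).mpr ?_)
        rw [← he]
        exact h
      have h2 : algebraMap T S a ∈ Ideal.span (Set.range t) :=
        (Ideal.mul_unit_mem_iff_mem _ hu).mp h1
      rw [IsLocalization.mk'_eq_mul_mk'_one]
      exact Ideal.mul_mem_right _ _ h2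
  let I := RingHom.ker φ
  have hI : I.IsPrime := RingHom.ker_isPrime φ
  have hmem (z : MvPolynomial (Fin n) k) (hz : g z ∈ p) :
      algebraMap T S (g z ⊗ₜ 1) ∈ maximalIdeal S := by
    rw [← Localization.AtPrime.map_eq_maximalIdeal]
    exact Ideal.mem_map_of_mem _ (by simpa [δ, hm] using hz)
  have hflat' : ((algebraMap A R).comp g.toRingHom).Flat :=
    hflat.comp (RingHom.flat_algebraMap_iff.mpr (IsLocalization.flat R p.primeCompl))
  have hgπ : algebraMap A R (g π) ≠ 0 := by
    intro h
    have := mem_map_of_flat hflat' (J := ⊥) (t := π) (x := 1)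
      (fun x hx ↦ by simpa [hπ.ne_zero] using hx) (by simpa using h)
    simp at this
  have hsup (c z : T) (x : S) : algebraMap T S c * x ∈ Ideal.span {algebraMap T S z} ⊔ I ↔
      algebraMap A R (m c) * φ x ∈ Ideal.span {algebraMap A R (m z)} := by
    rw [mem_span_singleton_sup, Ideal.mem_span_singleton']
    simp only [I, RingHom.mem_ker, map_sub, map_mul, hφ, sub_eq_zero]
    constructor
    · rintro ⟨s, hs⟩
      exact ⟨φ s, by rw [hs, _root_.mul_comm]⟩
    · rintro ⟨s, hs⟩
      obtain ⟨s, rfl⟩ := hφs s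
      exact ⟨s, by rw [← hs, _root_.mul_comm]⟩
  -- The quotient `S ⧸ I ≅ R` has depth at least two: `π`, `y` is a regular sequence in the
  -- polynomial ring, and flatness preserves this.
  have hbase := ExtendsFrom.of_depth hI (hmem π hπp) (hmem y hyp)
    (fun x hx ↦ by
      rw [RingHom.mem_ker, map_mul, hφ, hm] at hx
      exact (mul_eq_zero.mp hx).resolve_left hgπ)
    (fun x hx ↦ by
      have h1 := (hsup (g y ⊗ₜ 1) (g π ⊗ₜ 1) x).mp hx
      rw [hm, hm] at h1
      have h2 : φ x ∈ (Ideal.span {π}).map ((algebraMap A R).comp g.toRingHom) := by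
        refine mem_map_of_flat hflat' (t := y) (fun z hz ↦ ?_) ?_
        · rw [Ideal.mem_span_singleton] at hz ⊢
          exact (hπ.dvd_or_dvd hz).resolve_left hπy
        · rw [Ideal.map_span, Set.image_singleton]
          exact h1
      rw [Ideal.map_span, Set.image_singleton] at h2
      have := (hsup 1 (g π ⊗ₜ 1) x).mpr (by rw [hm, map_one, map_one, _root_.one_mul]; exact h2)
      rwa [map_one, _root_.one_mul] at this)
  have hIm : I ≠ maximalIdeal S := by
    intro h
    have := hmem π hπp
    rw [← h, RingHom.mem_ker, hφ, hm] at this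
    exact hgπ this
  have hext : ExtendsFrom {P | P.IsPrime ∧ I ≤ P ∧ P ≠ maximalIdeal S} ⊥ := by
    refine ExtendsFrom.of_isRegSeq htreg (fun i ↦ ?_) ?_ ?_ ?_
    · exact le_maximalIdeal hI.ne_top (hspan.le (Ideal.subset_span ⟨i, rfl⟩))
    · rw [hspan]; exact hI
    · rw [hspan]; exact ⟨I, ⟨hI, le_rfl, hIm⟩, le_rfl⟩
    · rw [hspan]; exact hbase
  obtain ⟨a, b, hb, rfl⟩ := IsFractionRing.div_surjective (A := T) f
  have hb0 : b ≠ 0 := nonZeroDivisors.ne_zero hb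
  have hbF : algebraMap T F b ≠ 0 := by simpa using hb0
  have hfrac (c d : T) : algebraMap T F c * (algebraMap T F a / algebraMap T F b) =
      algebraMap T F d ↔ c * a = b * d := by
    rw [← mul_div_assoc, div_eq_iff hbF, ← map_mul, ← map_mul,
      (IsFractionRing.injective T F).eq_iff, _root_.mul_comm d]
  have := hext (algebraMap T S a) (algebraMap T S b)
    (by simpa using (map_ne_zero_iff _ hTS).mpr hb0) fun P ⟨hP, hIP, hPm⟩ ↦ by
      -- A non-maximal prime of `S` containing `I` comes from the diagonal prime of some `q < p`,
      -- where `H` applies.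
      let P' : Ideal R := P.map φ
      have hP' : P'.IsPrime := Ideal.map_isPrime_of_surjective hφs hIP
      have hcomap : P'.comap φ = P := by
        rw [Ideal.comap_map_of_surjective' φ hφs]
        exact sup_eq_left.mpr hIP
      let q : Ideal A := P'.comap (algebraMap A R)
      have hq : q ≤ p := by
        rw [← IsLocalization.AtPrime.under_maximalIdeal R p]
        exact Ideal.comap_mono (le_maximalIdeal hP'.ne_top)
      have hqp : q ≠ p := by
        intro h
        have h1 : maximalIdeal R ≤ P' := by
          rw [← Localization.AtPrime.map_eq_maximalIdeal, Ideal.map_le_iff_le_comap]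
          exact h.ge
        refine hPm ((le_maximalIdeal hP.ne_top).antisymm ?_)
        rw [← hcomap]
        refine le_trans ?_ (Ideal.comap_mono h1)
        have : IsLocalHom φ := Localization.isLocalHom_localRingHom _ _ _ _
        exact ((local_hom_TFAE φ).out 0 3 rfl rfl).mp this
      obtain ⟨d, c, hc, hcd⟩ := H q (Ideal.comap_isPrime (algebraMap A R) P' (H := hP')) (lt_of_le_of_ne hq hqp)
      refine ⟨algebraMap T S c, fun h ↦ hc ?_, ?_⟩
      · have := Ideal.mem_map_of_mem φ h
        rw [hφ] at this
        exact this
      · rw [← map_mul, (hfrac c d).mp hcd, map_mul]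
        exact Ideal.mem_sup_left (Ideal.mul_mem_right _ _ (Ideal.mem_span_singleton_self _))
  rw [sup_bot_eq, Ideal.mem_span_singleton'] at this
  obtain ⟨s, hs⟩ := this
  obtain ⟨d, c, rfl⟩ := IsLocalization.exists_mk'_eq δ.primeCompl s
  refine ⟨d, c, c.2, (hfrac _ _).mpr (hTS ?_)⟩
  have := IsLocalization.mk'_spec S d c
  rw [map_mul, map_mul, ← hs, ← this]
  ring

include hg in
-- The dichotomy is whether the contraction of `p` to the polynomial ring is principal. If so,
-- unramifiedness makes the maximal ideal of `A_p` principal, and a noetherian local domain with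
-- this property is a valuation ring. If not, unique factorization provides `π` and `y`.
theorem exists_prime_or_valuationRing [IsNoetherianRing A] (p : Ideal A) [p.IsPrime] :
    (∃ π y, Prime π ∧ g π ∈ p ∧ g y ∈ p ∧ ¬ π ∣ y) ∨ ValuationRing (Localization.AtPrime p) := by
  rw [or_iff_not_imp_left]
  intro H
  algebraize [g.toRingHom]
  let P := MvPolynomial (Fin n) k
  let q : Ideal P := p.under P
  have hq : q.IsPrincipal := by
    by_cases h0 : q = ⊥
    · rw [h0]; infer_instance
    obtain ⟨z, hz, hz0⟩ := Submodule.exists_mem_ne_zero_of_ne_bot h0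
    obtain ⟨π, hπ, hπp⟩ := Ideal.IsPrime.exists_mem_prime_of_ne_bot (I := q) inferInstance h0
    refine ⟨π, le_antisymm (fun y hy ↦ ?_) ?_⟩
    · by_contra hcon
      exact H ⟨π, y, hπp, hπ, hy, fun h ↦ hcon (Ideal.mem_span_singleton.mpr h)⟩
    · exact (Ideal.span_singleton_le_iff_mem _).mpr hπ
  let := Localization.AtPrime.algebraOfLiesOver q p
  have hmap := ((Algebra.isUnramifiedAt_iff_map_eq P q p).mp inferInstance).2
  have : IsNoetherianRing (Localization.AtPrime p) :=
    IsLocalization.isNoetherianRing p.primeCompl _ inferInstance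
  refine ((tfae_of_isNoetherianRing_of_isLocalRing_of_isDomain
    (Localization.AtPrime p)).out 4 1).mp ?_
  rw [← hmap]
  obtain ⟨π, hπ⟩ := hq
  refine ⟨algebraMap P _ π, ?_⟩
  rw [hπ, Ideal.submodule_span_eq, Ideal.map_span, Set.image_singleton]

end Extension

/-! ### Local rings inside function fields, and faithfully flat descent of regularity. -/

section Fractions

open scoped TensorProduct

section

variable (k : Type*) {A T : Type*} [CommRing k] [CommRing A] [CommRing T] [IsDomain A] [IsDomain T]
  [Algebra k A] [Algebra k T]

/-- The inclusion of a local ring of a domain into the field of fractions. -/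
noncomputable def locToFrac (p : Ideal A) [p.IsPrime] :
    Localization.AtPrime p →ₐ[k] FractionRing A :=
  IsLocalization.liftAlgHom (M := p.primeCompl)
    (f := IsScalarTower.toAlgHom k A (FractionRing A)) fun y ↦
      (IsLocalization.map_units (FractionRing A)
        ⟨y.1, p.primeCompl_le_nonZeroDivisors y.2⟩ : IsUnit (algebraMap A (FractionRing A) y.1))

@[simp]
theorem locToFrac_algebraMap (p : Ideal A) [p.IsPrime] (a : A) :
    locToFrac k p (algebraMap A _ a) = algebraMap A (FractionRing A) a := by
  exact IsLocalization.lift_eq _ _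

theorem locToFrac_mk' (p : Ideal A) [p.IsPrime] (a : A) (s : p.primeCompl) :
    algebraMap A _ s.1 * locToFrac k p (IsLocalization.mk' _ a s) =
      algebraMap A (FractionRing A) a := by
  rw [← locToFrac_algebraMap k p, ← map_mul, _root_.mul_comm, IsLocalization.mk'_spec,
    locToFrac_algebraMap]

theorem locToFrac_injective (p : Ideal A) [p.IsPrime] : Function.Injective (locToFrac k p) := by
  rw [injective_iff_map_eq_zero]
  intro x hx
  obtain ⟨a, s, rfl⟩ := IsLocalization.exists_mk'_eq p.primeCompl x
  have := locToFrac_mk' k p a s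
  rw [hx, mul_zero] at this
  have ha : a = 0 := IsFractionRing.injective A (FractionRing A) (by rw [← this, map_zero])
  simp [ha]

theorem mem_range_locToFrac_iff (p : Ideal A) [p.IsPrime] (x : FractionRing A) :
    x ∈ (locToFrac k p).range ↔ ∃ a b : A, b ∉ p ∧ algebraMap A _ b * x = algebraMap A _ a := by
  constructor
  · rintro ⟨y, rfl⟩
    obtain ⟨a, s, rfl⟩ := IsLocalization.exists_mk'_eq p.primeCompl y
    exact ⟨a, s, s.2, locToFrac_mk' k p a s⟩
  · rintro ⟨a, b, hb, h⟩
    refine ⟨IsLocalization.mk' _ a (⟨b, hb⟩ : p.primeCompl), ?_⟩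
    have hb0 : algebraMap A (FractionRing A) b ≠ 0 := by
      rw [map_ne_zero_iff _ (IsFractionRing.injective A _)]
      rintro rfl
      exact hb p.zero_mem
    exact mul_left_cancel₀ hb0 ((locToFrac_mk' k p a ⟨b, hb⟩).trans h.symm)

variable {k}

/-- The extension of an injective homomorphism of domains to the fields of fractions. -/
noncomputable def fracMap (f : A →ₐ[k] T) (hf : Function.Injective f) :
    FractionRing A →ₐ[k] FractionRing T :=
  IsFractionRing.liftAlgHom (g := (IsScalarTower.toAlgHom k T (FractionRing T)).comp f)
    ((IsFractionRing.injective T (FractionRing T)).comp hf)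

@[simp]
theorem fracMap_algebraMap (f : A →ₐ[k] T) (hf : Function.Injective f) (a : A) :
    fracMap f hf (algebraMap A _ a) = algebraMap T _ (f a) := by
  exact IsFractionRing.lift_algebraMap (g := (algebraMap T (FractionRing T)).comp f.toRingHom)
    ((IsFractionRing.injective T (FractionRing T)).comp hf) a

theorem locToFrac_comp_localAlgHom (f : A →ₐ[k] T) (hf : Function.Injective f) (p : Ideal A)
    [p.IsPrime] (q : Ideal T) [q.IsPrime] (h : p = q.comap f) :
    (locToFrac k q).comp (Localization.localAlgHom p q f h) =
      (fracMap f hf).comp (locToFrac k p) := by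
  refine AlgHom.coe_ringHom_injective (IsLocalization.ringHom_ext p.primeCompl ?_)
  ext a
  have := Localization.localRingHom_to_map p q f.toRingHom h a
  exact (congrArg (locToFrac k q) this).trans ((locToFrac_algebraMap k q _).trans
    ((fracMap_algebraMap f hf a).symm.trans
      (congrArg (fracMap f hf) (locToFrac_algebraMap k p a).symm)))

end

section

variable {k A : Type*} [Field k] [CommRing A] [Algebra k A]

theorem flat_includeRight {B : Type*} [CommRing B] [Algebra k B] :
    (Algebra.TensorProduct.includeRight (R := k) (A := B) (B := A)).Flat := by
  have h : (Algebra.TensorProduct.map (Algebra.ofId k B) (AlgHom.id k A)).Flat :=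
    RingHom.Flat.tensorProductMap (RingHom.flat_algebraMap_iff.mpr inferInstance) (RingHom.Flat.id A)
  have h0 : ((Algebra.TensorProduct.lid k A).symm : A →ₐ[k] k ⊗[k] A).Flat :=
    RingHom.Flat.of_bijective (Algebra.TensorProduct.lid k A).symm.bijective
  have h' := RingHom.Flat.comp h0 h
  convert h' using 1
  ext a
  change (1 : B) ⊗ₜ[k] a = algebraMap k B 1 ⊗ₜ[k] a
  rw [map_one]

theorem exists_prime_le_comap_eq_bot {C : Type*} [CommRing C] [IsDomain A] {f : A →+* C}
    (hf : f.Flat) (Q₀ : Ideal C) [hQ₀ : Q₀.IsPrime] :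
    ∃ Q : Ideal C, Q.IsPrime ∧ Q ≤ Q₀ ∧ Q.comap f = ⊥ := by
  have hgen := hf.generalizingMap_comap
  have h0 : (⟨⊥, Ideal.isPrime_bot⟩ : PrimeSpectrum A) ⤳ PrimeSpectrum.comap f ⟨Q₀, hQ₀⟩ := by
    rw [← PrimeSpectrum.le_iff_specializes]
    exact bot_le (α := Ideal A)
  obtain ⟨Q, hQ, hQ'⟩ := hgen h0
  exact ⟨Q.asIdeal, Q.2, (PrimeSpectrum.le_iff_specializes _ _).mpr hQ,
    congrArg PrimeSpectrum.asIdeal hQ'⟩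

/-- This is a point `(u, v)` with `u` at `p` and `v` generic, specializing to the diagonal point of
`p`. It comes from going down along the flat map `A → (A ⧸ p) ⊗ A`, starting at the kernel of
multiplication to `A ⧸ p`. -/
theorem exists_prime_le_diagPrime [IsDomain A] (p : Ideal A) [p.IsPrime] :
    ∃ q : Ideal (A ⊗[k] A), q.IsPrime ∧ q ≤ diagPrime k p ∧
      p = q.comap (Algebra.TensorProduct.includeLeft (R := k) (S := k) (A := A) (B := A)) ∧
      ⊥ = q.comap (Algebra.TensorProduct.includeRight (R := k) (A := A) (B := A)) := by
  obtain ⟨F, hF⟩ : ∃ F : A ⊗[k] A →ₐ[k] (A ⧸ p) ⊗[k] A,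
      ∀ a b, F (a ⊗ₜ b) = Ideal.Quotient.mk p a ⊗ₜ b :=
    ⟨Algebra.TensorProduct.map (Ideal.Quotient.mkₐ k p) (AlgHom.id k A), fun a b ↦
      Algebra.TensorProduct.map_tmul _ _ _ _⟩
  obtain ⟨m, hm⟩ : ∃ m : (A ⧸ p) ⊗[k] A →ₐ[k] A ⧸ p,
      ∀ a b, m (a ⊗ₜ b) = a * Ideal.Quotient.mk p b :=
    ⟨Algebra.TensorProduct.lift (AlgHom.id k _) (Ideal.Quotient.mkₐ k p) fun _ _ ↦ Commute.all _ _,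
      fun a b ↦ Algebra.TensorProduct.lift_tmul _ _ _ _ _⟩
  have hmF (z : A ⊗[k] A) : m (F z) =
      Ideal.Quotient.mk p (Algebra.TensorProduct.lmul' (S := A) k z) := by
    induction z with
    | zero => simp only [map_zero]
    | tmul a b => rw [hF, hm, Algebra.TensorProduct.lmul'_apply_tmul, map_mul]
    | add x y hx hy => rw [map_add, map_add, map_add, map_add, hx, hy]
  obtain ⟨Q, hQp, hQ, hQbot⟩ := exists_prime_le_comap_eq_bot (A := A)
    (flat_includeRight (k := k) (A := A) (B := A ⧸ p)) (RingHom.ker m.toRingHom)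
      (hQ₀ := RingHom.ker_isPrime m.toRingHom)
  refine ⟨Q.comap F.toRingHom, inferInstance, fun z hz ↦ ?_, le_antisymm ?_ ?_, ?_⟩
  · have : m (F z) = 0 := hQ hz
    rw [hmF, Ideal.Quotient.eq_zero_iff_mem] at this
    exact this
  · intro a ha
    have h1 : F (a ⊗ₜ 1) = 0 := by
      rw [hF, Ideal.Quotient.eq_zero_iff_mem.mpr ha, TensorProduct.zero_tmul]
    change F (a ⊗ₜ 1) ∈ Q
    rw [h1]
    exact zero_mem _
  · intro a ha
    have : m (F (a ⊗ₜ 1)) = 0 := hQ ha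
    rw [hmF, Ideal.Quotient.eq_zero_iff_mem, Algebra.TensorProduct.lmul'_apply_tmul,
      _root_.mul_one] at this
    exact this
  · rw [← hQbot]
    ext a
    change (1 : A ⧸ p) ⊗ₜ[k] a ∈ Q ↔ F (1 ⊗ₜ a) ∈ Q
    rw [hF, map_one]

/-- For `x = a / b`, faithful flatness gives `b R' ∩ R = b R`, so divisibility of `a` by `b`
descends to `R`. -/
theorem mem_range_of_faithfullyFlat {R R' K F : Type*} [CommRing R] [CommRing R'] [Field K]
    [CommRing F] [IsDomain R] [Algebra R K] [IsFractionRing R K] {φ : R →+* R'} (hφ : φ.FaithfullyFlat)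
    {i : R' →+* F} (hi : Function.Injective i) {j : K →+* F}
    (h : j.comp (algebraMap R K) = i.comp φ) {x : K} (hx : j x ∈ i.range) :
    x ∈ (algebraMap R K).range := by
  obtain ⟨s, hs⟩ := hx
  obtain ⟨a, b, hb, rfl⟩ := IsFractionRing.div_surjective (A := R) x
  have hb0 : algebraMap R K b ≠ 0 := by
    rw [map_ne_zero_iff _ (IsFractionRing.injective R K)]
    exact nonZeroDivisors.ne_zero hb
  have h' (r : R) : j (algebraMap R K r) = i (φ r) := congr($h r)
  have h1 : φ a = φ b * s := by
    apply hi
    rw [map_mul, hs, ← h', ← h', ← map_mul, mul_div_cancel₀ _ hb0]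
  algebraize [φ]
  have h2 : a ∈ Ideal.comap (algebraMap R R') (Ideal.map (algebraMap R R') (Ideal.span {b})) := by
    rw [Ideal.mem_comap, Ideal.map_span, Set.image_singleton, Ideal.mem_span_singleton]
    exact ⟨s, h1⟩
  rw [Ideal.comap_map_eq_self_of_faithfullyFlat, Ideal.mem_span_singleton] at h2
  obtain ⟨c, rfl⟩ := h2
  exact ⟨c, by rw [map_mul, mul_div_cancel_left₀ _ hb0]⟩

end

theorem exists_comp_eq_of_forall_mem_range {C D F : Type*} [CommRing C] [CommRing D] [CommRing F]
    (i : D →+* F) (hi : Function.Injective i) (θ : C →+* F) (h : ∀ c, θ c ∈ i.range) :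
    ∃ θ' : C →+* D, i.comp θ' = θ := by
  let e : D ≃+* i.range := RingEquiv.ofBijective i.rangeRestrict
    ⟨fun a b hab ↦ hi congr(($hab).1), i.rangeRestrict_surjective⟩
  refine ⟨e.symm.toRingHom.comp (θ.codRestrict i.range h), ?_⟩
  ext c
  exact congr(($(e.apply_symm_apply ⟨θ c, h c⟩)).1)

end Fractions

/-! ### Morphisms from spectra of `k`-algebras and their extensions. -/

section SpecOver

variable (k : Type u) [Field k]

/-- The spectrum of a `k`-algebra, as a `k`-scheme. -/
noncomputable abbrev specOver (R : Type u) [CommRing R] [Algebra k R] : Over (Spec (.of k)) :=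
  Over.mk (Spec.map (CommRingCat.ofHom (algebraMap k R)))

variable {k} {R R' R'' F F' : Type u} [CommRing R] [CommRing R'] [CommRing R''] [CommRing F]
  [CommRing F'] [Algebra k R] [Algebra k R'] [Algebra k R''] [Algebra k F] [Algebra k F']

/-- The morphism of `k`-schemes induced by a homomorphism of `k`-algebras. -/
noncomputable def specOverMap (f : R →ₐ[k] R') : specOver k R' ⟶ specOver k R :=
  Over.homMk (Spec.map (CommRingCat.ofHom f.toRingHom)) (by
    dsimp
    rw [← Spec.map_comp, ← CommRingCat.ofHom_comp]
    congr 2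
    exact f.comp_algebraMap)

@[simp]
theorem specOverMap_id : specOverMap (AlgHom.id k R) = 𝟙 _ := by
  ext1
  exact Spec.map_id _

theorem specOverMap_comp (f : R →ₐ[k] R') (g : R' →ₐ[k] R'') :
    specOverMap (g.comp f) = specOverMap g ≫ specOverMap f := by
  ext1
  exact Spec.map_comp (CommRingCat.ofHom f.toRingHom) (CommRingCat.ofHom g.toRingHom)

variable {B : Over (Spec (.of k))}

/-- A morphism from `Spec F` extends along `Spec F ⟶ Spec R`. -/
def ExtendsAlong (i : R →ₐ[k] F) (φ : specOver k F ⟶ B) : Prop :=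
  ∃ χ : specOver k R ⟶ B, specOverMap i ≫ χ = φ

theorem ExtendsAlong.comp {i : R →ₐ[k] F} {φ : specOver k F ⟶ B} (h : ExtendsAlong i φ)
    {f : R →ₐ[k] R'} {i' : R' →ₐ[k] F'} {j : F →ₐ[k] F'} (e : i'.comp f = j.comp i) :
    ExtendsAlong i' (specOverMap j ≫ φ) := by
  obtain ⟨χ, rfl⟩ := h
  exact ⟨specOverMap f ≫ χ, by
    rw [← Category.assoc, ← specOverMap_comp, e, specOverMap_comp, Category.assoc]⟩

theorem ExtendsAlong.comp_right {i : R →ₐ[k] F} {φ : specOver k F ⟶ B} (h : ExtendsAlong i φ)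
    {B' : Over (Spec (.of k))} (g : B ⟶ B') : ExtendsAlong i (φ ≫ g) := by
  obtain ⟨χ, rfl⟩ := h
  exact ⟨χ ≫ g, by rw [Category.assoc]⟩

theorem ExtendsAlong.lift {i : R →ₐ[k] F} {B' : Over (Spec (.of k))} {φ : specOver k F ⟶ B}
    {φ' : specOver k F ⟶ B'} (h : ExtendsAlong i φ) (h' : ExtendsAlong i φ') :
    ExtendsAlong i (lift φ φ') := by
  obtain ⟨χ, rfl⟩ := h
  obtain ⟨χ', rfl⟩ := h'
  exact ⟨CartesianMonoidalCategory.lift χ χ', comp_lift _ _ _⟩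

theorem exists_specMap_fromSpec_eq {D : Type u} [CommRing D] [IsLocalRing D] {B : Scheme.{u}}
    (χ : Spec (.of D) ⟶ B) {V : B.Opens} (hV : IsAffineOpen V)
    (h : χ (IsLocalRing.closedPoint D) ∈ V) :
    ∃ θ : Γ(B, V) ⟶ .of D, Spec.map θ ≫ hV.fromSpec = χ := by
  have hr : Set.range χ ⊆ Set.range hV.fromSpec := by
    rw [hV.range_fromSpec]
    have : χ ⁻¹ᵁ V = ⊤ := (IsLocalRing.closed_point_mem_iff (R := D)).mp h
    rintro _ ⟨x, rfl⟩
    exact (this ▸ trivial : x ∈ χ ⁻¹ᵁ V)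
  refine ⟨Spec.preimage (IsOpenImmersion.lift hV.fromSpec χ hr), ?_⟩
  rw [Spec.map_preimage, IsOpenImmersion.lift_fac]

theorem ExtendsAlong.of_forall_mem_range {i : R →ₐ[k] F} (hi : Function.Injective i)
    {φ : specOver k F ⟶ B} {V : B.left.Opens} (hV : IsAffineOpen V)
    {θ : Γ(B.left, V) ⟶ .of F} (hθ : Spec.map θ ≫ hV.fromSpec = φ.left)
    (h : ∀ c, θ c ∈ i.range) : ExtendsAlong i φ := by
  obtain ⟨θ', hθ'⟩ := exists_comp_eq_of_forall_mem_range i.toRingHom hi θ.hom h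
  have hfac : Spec.map (CommRingCat.ofHom i.toRingHom) ≫ Spec.map (CommRingCat.ofHom θ') =
      Spec.map θ := by
    rw [← Spec.map_comp, ← CommRingCat.ofHom_comp, hθ', CommRingCat.ofHom_hom]
  have hover : (Spec.map (CommRingCat.ofHom θ') ≫ hV.fromSpec) ≫ B.hom =
      Spec.map (CommRingCat.ofHom (algebraMap k R)) := by
    obtain ⟨α, hα⟩ := Spec.map_surjective
      ((Spec.map (CommRingCat.ofHom θ') ≫ hV.fromSpec) ≫ B.hom)
    have h1 : Spec.map (CommRingCat.ofHom i.toRingHom) ≫ Spec.map α =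
        Spec.map (CommRingCat.ofHom (algebraMap k F)) := by
      rw [hα, Category.assoc, ← Category.assoc, hfac, ← Category.assoc, hθ]
      exact Over.w φ
    rw [← hα]
    rw [← Spec.map_comp] at h1
    have h2 := Spec.map_injective h1
    congr 1
    ext a
    apply hi
    have := congr($(h2).hom a)
    exact this.trans (i.commutes a).symm
  refine ⟨Over.homMk (Spec.map (CommRingCat.ofHom θ') ≫ hV.fromSpec) hover, ?_⟩
  ext1
  rw [← hθ, ← hfac, Category.assoc]
  rfl

end SpecOver

/-! ### Subtraction in a torsor. -/

section Torsor

variable {k : Type u} [Field k] {B Q : Over (Spec (.of k))} [GrpObj B] {ρ : B ⊗ Q ⟶ Q}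

/-- The difference of two points of a torsor. -/
noncomputable def IsTorsor.diff (h : IsTorsor ρ) {T : Over (Spec (.of k))} (a b : T ⟶ Q) : T ⟶ B :=
  haveI := h.isIso
  lift a b ≫ inv (lift ρ (snd B Q)) ≫ fst B Q

theorem IsTorsor.comp_diff (h : IsTorsor ρ) {T T' : Over (Spec (.of k))} (t : T' ⟶ T)
    (a b : T ⟶ Q) : t ≫ h.diff a b = h.diff (t ≫ a) (t ≫ b) := by
  have := h.isIso
  rw [diff, diff, ← Category.assoc, comp_lift]

theorem IsTorsor.eq_lift_diff (h : IsTorsor ρ) {T : Over (Spec (.of k))} (a b : T ⟶ Q) :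
    have := h.isIso
    lift a b ≫ inv (lift ρ (snd B Q)) = lift (h.diff a b) b := by
  have := h.isIso
  intro _
  apply CartesianMonoidalCategory.hom_ext
  · rw [lift_fst, diff, Category.assoc]
  · have h1 : (lift a b ≫ inv (lift ρ (snd B Q))) ≫ lift ρ (snd B Q) = lift a b := by
      rw [Category.assoc, IsIso.inv_hom_id, Category.comp_id]
    have h2 := congr($h1 ≫ snd _ _)
    rw [Category.assoc, lift_snd, lift_snd] at h2
    rw [h2, lift_snd]

theorem IsTorsor.lift_diff_act (h : IsTorsor ρ) {T : Over (Spec (.of k))} (a b : T ⟶ Q) :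
    lift (h.diff a b) b ≫ ρ = a := by
  have := h.isIso
  rw [← h.eq_lift_diff]
  have h1 : (lift a b ≫ inv (lift ρ (snd B Q))) ≫ lift ρ (snd B Q) = lift a b := by
      rw [Category.assoc, IsIso.inv_hom_id, Category.comp_id]
  have h2 := congr($h1 ≫ fst _ _)
  rwa [Category.assoc, lift_fst, lift_fst] at h2

theorem IsTorsor.diff_act (h : IsTorsor ρ) {T : Over (Spec (.of k))} (g : T ⟶ B) (b : T ⟶ Q) :
    h.diff (lift g b ≫ ρ) b = g := by
  have := h.isIso
  have h1 : lift (lift g b ≫ ρ) b = lift g b ≫ lift ρ (snd B Q) := by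
    rw [comp_lift, lift_snd]
  rw [diff, h1, Category.assoc, IsIso.hom_inv_id_assoc, lift_fst]

theorem IsTorsor.diff_self (h : IsTorsor ρ) {T : Over (Spec (.of k))} (a : T ⟶ Q) :
    h.diff a a = toUnit T ≫ η := by
  have h1 : lift (toUnit T ≫ η) a ≫ ρ = a := by
    have h2 := congr(lift (toUnit T) a ≫ $(h.one_act))
    rw [lift_whiskerRight_assoc] at h2
    rw [h2]
    simp
  conv_lhs => rw [← h1]
  have := h.diff_act (toUnit T ≫ η) a
  rwa [h1] at this ⊢

end Torsor

/-! ### Weil's extension theorem at a prime of an étale chart. -/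

section LocalExtension

open scoped TensorProduct

variable {k : Type u} [Field k] {B Q : Over (Spec (.of k))}

theorem ExtendsAlong.of_valuationRing [UniversallyClosed Q.hom] {D F : Type u} [CommRing D]
    [IsDomain D] [ValuationRing D] [Field F] [Algebra k D] [Algebra k F] (i : D →ₐ[k] F)
    (hi : @IsFractionRing D _ F _ i.toRingHom.toAlgebra) (φ : specOver k F ⟶ Q) :
    ExtendsAlong i φ := by
  let := i.toRingHom.toAlgebra
  have hex : ValuativeCriterion.Existence Q.hom := by
    have := UniversallyClosed.eq_valuativeCriterion ▸ (inferInstance : UniversallyClosed Q.hom)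
    exact this.1
  let S : ValuativeCommSq Q.hom :=
    { R := D
      K := F
      i₁ := φ.left
      i₂ := Spec.map (CommRingCat.ofHom (algebraMap k D))
      commSq := ⟨(Over.w φ).trans (Over.w (specOverMap i)).symm⟩ }
  obtain ⟨⟨l, hl, hl'⟩⟩ := (hex S).exists_lift
  refine ⟨Over.homMk l hl', ?_⟩
  ext1
  exact hl

theorem comap_includeLeft_diagPrime {A : Type*} [CommRing A] [Algebra k A] (p : Ideal A) :
    p = (diagPrime k p).comap
      (Algebra.TensorProduct.includeLeft (R := k) (S := k) (A := A) (B := A)) := by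
  ext a
  change a ∈ p ↔ Algebra.TensorProduct.lmul' (S := A) k (a ⊗ₜ 1) ∈ p
  rw [Algebra.TensorProduct.lmul'_apply_tmul, _root_.mul_one]

theorem comap_includeRight_diagPrime {A : Type*} [CommRing A] [Algebra k A] (p : Ideal A) :
    p = (diagPrime k p).comap
      (Algebra.TensorProduct.includeRight (R := k) (A := A) (B := A)) := by
  ext a
  change a ∈ p ↔ Algebra.TensorProduct.lmul' (S := A) k (1 ⊗ₜ a) ∈ p
  rw [Algebra.TensorProduct.lmul'_apply_tmul, _root_.one_mul]

theorem localAlgHom_comp_eq_id {A T : Type*} [CommRing A] [Algebra k A] [CommRing T] [Algebra k T]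
    (p : Ideal A) [p.IsPrime] (q : Ideal T) [q.IsPrime] (f : A →ₐ[k] T) (g : T →ₐ[k] A)
    (hgf : g.comp f = AlgHom.id k A) (h : p = q.comap f) (h' : q = p.comap g) :
    (Localization.localAlgHom q p g h').comp (Localization.localAlgHom p q f h) =
      AlgHom.id k _ := by
  refine AlgHom.coe_ringHom_injective (IsLocalization.ringHom_ext p.primeCompl ?_)
  ext a
  have h1 := Localization.localRingHom_to_map p q f.toRingHom h a
  have h2 := Localization.localRingHom_to_map q p g.toRingHom h' (f a)
  have h3 : g (f a) = a := congr($hgf a)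
  exact (congrArg (Localization.localAlgHom q p g h') h1).trans
    (h2.trans (congrArg (algebraMap A _) h3))

variable {A : Type u} [CommRing A] [Algebra k A] [GrpObj B] {ρ : B ⊗ Q ⟶ Q}

theorem includeLeft_inj : Function.Injective
    (Algebra.TensorProduct.includeLeft (R := k) (S := k) (A := A) (B := A)) := by
  nontriviality A
  exact Algebra.TensorProduct.includeLeft_injective (FaithfulSMul.algebraMap_injective k A)

theorem includeRight_inj : Function.Injective
    (Algebra.TensorProduct.includeRight (R := k) (A := A) (B := A)) := by
  nontriviality A
  exact Algebra.TensorProduct.includeRight_injective (FaithfulSMul.algebraMap_injective k A)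

variable [IsDomain A] [IsDomain (A ⊗[k] A)]

variable (k A) in
/-- The first inclusion of the function field of `Spec A` into that of `Spec A × Spec A`. -/
noncomputable abbrev fracLeft : FractionRing A →ₐ[k] FractionRing (A ⊗[k] A) :=
  fracMap _ includeLeft_inj

variable (k A) in
/-- The second inclusion of the function field of `Spec A` into that of `Spec A × Spec A`. -/
noncomputable abbrev fracRight : FractionRing A →ₐ[k] FractionRing (A ⊗[k] A) :=
  fracMap _ includeRight_inj

/-- The rational map `(x, y) ↦ φ x - φ y`. -/
noncomputable abbrev diffFrac (h : IsTorsor ρ) (φ : specOver k (FractionRing A) ⟶ Q) :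
    specOver k (FractionRing (A ⊗[k] A)) ⟶ B :=
  h.diff (specOverMap (fracLeft k A) ≫ φ) (specOverMap (fracRight k A) ≫ φ)

/-- Where `φ` is defined, the difference map is defined at the diagonal point and restricts to the
identity section along the diagonal. The closed point therefore lands in `V`, and functions on `V`
pull back into the local ring. -/
theorem exists_specMap_fromSpec_eq_diffFrac (h : IsTorsor ρ)
    {φ : specOver k (FractionRing A) ⟶ Q} (y : Ideal A) [y.IsPrime]
    (hφ : ExtendsAlong (locToFrac k y) φ) {V : B.left.Opens} (hV : IsAffineOpen V)
    (he : ∀ z : (𝟙_ (Over (Spec (.of k)))).left, η[B].left z ∈ V) :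
    ∃ θ : Γ(B.left, V) ⟶ .of (FractionRing (A ⊗[k] A)),
      Spec.map θ ≫ hV.fromSpec = (diffFrac h φ).left ∧
      ∀ c, θ c ∈ (locToFrac k (diagPrime k y)).range := by
  obtain ⟨χ, rfl⟩ := hφ
  let a₁ := Localization.localAlgHom y (diagPrime k y) _ (comap_includeLeft_diagPrime y)
  let a₂ := Localization.localAlgHom y (diagPrime k y) _ (comap_includeRight_diagPrime y)
  let d := Localization.localAlgHom (diagPrime k y) y (Algebra.TensorProduct.lmul' (S := A) k) rfl
  have hd₁ : d.comp a₁ = AlgHom.id k _ := localAlgHom_comp_eq_id _ _ _ _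
    (by ext a; exact (Algebra.TensorProduct.lmul'_apply_tmul a 1).trans (_root_.mul_one a)) _ _
  have hd₂ : d.comp a₂ = AlgHom.id k _ := localAlgHom_comp_eq_id _ _ _ _
    (by ext a; exact (Algebra.TensorProduct.lmul'_apply_tmul 1 a).trans (_root_.one_mul a)) _ _
  let X := h.diff (specOverMap a₁ ≫ χ) (specOverMap a₂ ≫ χ)
  have hX : specOverMap (locToFrac k (diagPrime k y)) ≫ X =
      diffFrac h (specOverMap (locToFrac k y) ≫ χ) := by
    rw [h.comp_diff, ← Category.assoc, ← Category.assoc, ← specOverMap_comp, ← specOverMap_comp,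
      locToFrac_comp_localAlgHom _ includeLeft_inj, locToFrac_comp_localAlgHom _ includeRight_inj,
      specOverMap_comp, specOverMap_comp, Category.assoc, Category.assoc]
  have hdX : specOverMap d ≫ X = toUnit _ ≫ η := by
    rw [h.comp_diff, ← Category.assoc, ← Category.assoc, ← specOverMap_comp, ← specOverMap_comp,
      hd₁, hd₂, specOverMap_id, Category.id_comp, h.diff_self]
  have hloc : IsLocalHom d.toRingHom :=
    Localization.isLocalHom_localRingHom _ _ (Algebra.TensorProduct.lmul' (S := A) k).toRingHom rfl
  have hcl : X.left (IsLocalRing.closedPoint _) ∈ V := by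
    have h1 : Spec.map (CommRingCat.ofHom d.toRingHom) (IsLocalRing.closedPoint _) =
        IsLocalRing.closedPoint _ := IsLocalRing.comap_closedPoint d.toRingHom
    have h2 : X.left (Spec.map (CommRingCat.ofHom d.toRingHom) (IsLocalRing.closedPoint _)) =
        η[B].left ((toUnit (specOver k (Localization.AtPrime y))).left
          (IsLocalRing.closedPoint _)) :=
      congr(($hdX).left (IsLocalRing.closedPoint (Localization.AtPrime y)))
    rw [h1] at h2
    exact Set.mem_of_eq_of_mem h2 (he _)
  obtain ⟨θ, hθ⟩ := exists_specMap_fromSpec_eq X.left hV hcl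
  refine ⟨θ ≫ CommRingCat.ofHom (locToFrac k (diagPrime k y)).toRingHom, ?_, fun c ↦ ⟨θ c, rfl⟩⟩
  rw [← hX, Spec.map_comp, Category.assoc, hθ]
  rfl

theorem exists_isAffineOpen_forall_mem :
    ∃ V : B.left.Opens, IsAffineOpen V ∧
      ∀ z : (𝟙_ (Over (Spec (.of k)))).left, η[B].left z ∈ V := by
  have : Subsingleton (𝟙_ (Over (Spec (.of k)))).left :=
    inferInstanceAs (Subsingleton (PrimeSpectrum k))
  obtain ⟨z₀⟩ : Nonempty (𝟙_ (Over (Spec (.of k)))).left :=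
    inferInstanceAs (Nonempty (PrimeSpectrum k))
  obtain ⟨V, hV, hz, -⟩ := exists_isAffineOpen_mem_and_subset
    (X := B.left) (x := η[B].left z₀) (U := ⊤) trivial
  exact ⟨V, hV, fun z ↦ Subsingleton.elim z₀ z ▸ hz⟩

theorem ExtendsAlong.diffFrac_of_forall_lt [IsNoetherianRing (A ⊗[k] A)] (h : IsTorsor ρ)
    {n : ℕ} (g : MvPolynomial (Fin n) k →ₐ[k] A) (hg : g.toRingHom.Etale) (p : Ideal A) [p.IsPrime]
    {π y : MvPolynomial (Fin n) k} (hπ : Prime π) (hπp : g π ∈ p) (hyp : g y ∈ p) (hπy : ¬ π ∣ y)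
    {φ : specOver k (FractionRing A) ⟶ Q}
    (H : ∀ (q : Ideal A) [q.IsPrime], q < p → ExtendsAlong (locToFrac k q) φ) :
    ExtendsAlong (locToFrac k (diagPrime k p)) (diffFrac h φ) := by
  obtain ⟨V, hV, he⟩ := exists_isAffineOpen_forall_mem (B := B)
  have hbot : ⊥ < p := by
    rw [bot_lt_iff_ne_bot]
    rintro rfl
    have := mem_map_of_flat (etale_flat g hg) (J := ⊥) (t := π) (x := 1)
      (fun x hx ↦ by simpa [hπ.ne_zero] using hx) (by simpa using hπp)
    simp at this
  -- The prime `⊥ < p` already supplies the functions `θ c`; any other `q < p` yields the same ones,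
  -- because `hV.fromSpec` is a monomorphism.
  obtain ⟨θ, hθ, -⟩ := exists_specMap_fromSpec_eq_diffFrac h ⊥ (H ⊥ hbot) hV he
  refine ExtendsAlong.of_forall_mem_range (locToFrac_injective k _) hV hθ fun c ↦ ?_
  rw [mem_range_locToFrac_iff]
  refine exists_mul_eq_of_forall_lt g hg p hπ hπp hyp hπy _ fun q hq hqp ↦ ?_
  obtain ⟨θ', hθ', hr⟩ := exists_specMap_fromSpec_eq_diffFrac h q (H q hqp) hV he
  have : θ' = θ := Spec.map_injective ((cancel_mono hV.fromSpec).mp (hθ'.trans hθ.symm))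
  rw [← mem_range_locToFrac_iff k, ← this]
  exact hr c

theorem ExtendsAlong.of_diffFrac (h : IsTorsor ρ) (p : Ideal A) [p.IsPrime]
    {φ : specOver k (FractionRing A) ⟶ Q}
    (H : ExtendsAlong (locToFrac k (diagPrime k p)) (diffFrac h φ)) :
    ExtendsAlong (locToFrac k p) φ := by
  obtain ⟨q, hq, hqp, hq₁, hq₂⟩ := exists_prime_le_diagPrime (k := k) p
  have hbot : (locToFrac k (⊥ : Ideal A)).range = ⊤ := by
    rw [eq_top_iff]
    rintro x -
    rw [mem_range_locToFrac_iff]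
    obtain ⟨a, b, hb, rfl⟩ := IsFractionRing.div_surjective (A := A) x
    have hb0 := nonZeroDivisors.ne_zero hb
    refine ⟨a, b, hb0, mul_div_cancel₀ _ ?_⟩
    rwa [map_ne_zero_iff _ (IsFractionRing.injective A _)]
  -- The term `φ(v)` extends to `q` because `q` lies over the generic point in the second factor.
  have hφ₂ : ExtendsAlong (locToFrac k q) (specOverMap (fracRight k A) ≫ φ) := by
    have : ExtendsAlong (locToFrac k (⊥ : Ideal A)) φ := by
      let e : Localization.AtPrime (⊥ : Ideal A) ≃ₐ[k] FractionRing A :=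
        AlgEquiv.ofBijective (locToFrac k (⊥ : Ideal A))
          ⟨locToFrac_injective k _, AlgHom.range_eq_top _ |>.mp hbot⟩
      refine ⟨specOverMap e.symm.toAlgHom ≫ φ, ?_⟩
      rw [← Category.assoc, ← specOverMap_comp]
      have : (locToFrac k (⊥ : Ideal A)).comp e.symm.toAlgHom = AlgHom.id k _ := by
        ext x
        exact e.apply_symm_apply _
      rw [this, specOverMap_id, Category.id_comp]
    exact this.comp (locToFrac_comp_localAlgHom _ includeRight_inj _ _ hq₂)
  have hΦ : ExtendsAlong (locToFrac k q) (diffFrac h φ) := by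
    obtain ⟨χ, hχ⟩ := H
    have : ∃ u : Localization.AtPrime (diagPrime k p) →ₐ[k] Localization.AtPrime q,
        (locToFrac k q).comp u = locToFrac k (diagPrime k p) := by
      refine ⟨IsLocalization.liftAlgHom (M := (diagPrime k p).primeCompl)
        (f := IsScalarTower.toAlgHom k (A ⊗[k] A) (Localization.AtPrime q)) fun y ↦
          IsLocalization.map_units (Localization.AtPrime q)
            (⟨y.1, fun hy ↦ y.2 (hqp hy)⟩ : q.primeCompl), ?_⟩
      refine AlgHom.coe_ringHom_injective
        (IsLocalization.ringHom_ext (diagPrime k p).primeCompl ?_)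
      refine RingHom.ext fun a ↦ ?_
      exact (congrArg (locToFrac k q) (IsLocalization.lift_eq _ a)).trans
        ((locToFrac_algebraMap k q a).trans (locToFrac_algebraMap k _ a).symm)
    obtain ⟨u, hu⟩ := this
    exact ⟨specOverMap u ≫ χ, by rw [← Category.assoc, ← specOverMap_comp, hu, hχ]⟩
  have hφ₁ : ExtendsAlong (locToFrac k q) (specOverMap (fracLeft k A) ≫ φ) := by
    have := (hΦ.lift hφ₂).comp_right ρ
    rwa [h.lift_diff_act] at this
  obtain ⟨χ, hχ⟩ := hφ₁
  obtain ⟨V, hV, hz, -⟩ := exists_isAffineOpen_mem_and_subset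
    (X := Q.left) (x := χ.left (IsLocalRing.closedPoint _)) (U := ⊤) trivial
  obtain ⟨θ, hθ⟩ := exists_specMap_fromSpec_eq χ.left hV hz
  have hVtop : χ.left ⁻¹ᵁ V = ⊤ :=
    (IsLocalRing.closed_point_mem_iff (R := Localization.AtPrime q)).mp hz
  have hcl : φ.left (IsLocalRing.closedPoint _) ∈ V := by
    have h1 : Spec.map (CommRingCat.ofHom (fracLeft k A).toRingHom) (IsLocalRing.closedPoint _) =
      IsLocalRing.closedPoint _ := IsLocalRing.comap_closedPoint (fracLeft k A).toRingHom
    have h2 : χ.left (Spec.map (CommRingCat.ofHom (locToFrac k q).toRingHom)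
        (IsLocalRing.closedPoint (FractionRing (A ⊗[k] A)))) =
        φ.left (Spec.map (CommRingCat.ofHom (fracLeft k A).toRingHom)
          (IsLocalRing.closedPoint _)) :=
      congr(($hχ).left (IsLocalRing.closedPoint (FractionRing (A ⊗[k] A))))
    rw [h1] at h2
    refine Set.mem_of_eq_of_mem h2.symm ?_
    have : ∀ z, z ∈ χ.left ⁻¹ᵁ V := hVtop ▸ fun _ ↦ trivial
    exact this _
  obtain ⟨θ', hθ'⟩ := exists_specMap_fromSpec_eq φ.left hV hcl
  have hcomp : θ' ≫ CommRingCat.ofHom (fracLeft k A).toRingHom =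
      θ ≫ CommRingCat.ofHom (locToFrac k q).toRingHom := by
    refine Spec.map_injective ((cancel_mono hV.fromSpec).mp ?_)
    rw [Spec.map_comp, Category.assoc, hθ', Spec.map_comp, Category.assoc, hθ]
    exact congr(($hχ).left).symm
  refine ExtendsAlong.of_forall_mem_range (locToFrac_injective k _) hV hθ' fun c ↦ ?_
  let := (locToFrac k p).toRingHom.toAlgebra
  -- What remains is descent: `A_p → (A ⊗ A)_q` is flat and local, hence faithfully flat, so
  -- functions regular upstairs are regular at `p`.
  have hfr : IsFractionRing (Localization.AtPrime p) (FractionRing A) := by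
    have : IsScalarTower A (Localization.AtPrime p) (FractionRing A) :=
      .of_algebraMap_eq fun a ↦ (locToFrac_algebraMap k p a).symm
    exact IsFractionRing.isFractionRing_of_isDomain_of_isLocalization p.primeCompl _ _
  have hflat : (Algebra.TensorProduct.includeLeft (R := k) (S := k) (A := A) (B := A)).Flat :=
    RingHom.flat_algebraMap_iff.mpr (inferInstanceAs (Module.Flat A (A ⊗[k] A)))
  have hff : (Localization.localAlgHom p q _ hq₁).toRingHom.FaithfullyFlat := by
    have hloc : IsLocalHom (Localization.localAlgHom p q _ hq₁).toRingHom :=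
      Localization.isLocalHom_localRingHom p q
        (Algebra.TensorProduct.includeLeft (R := k) (S := k) (A := A) (B := A)).toRingHom hq₁
    have hfl : (Localization.localAlgHom p q _ hq₁).toRingHom.Flat :=
      RingHom.Flat.localRingHom hflat q p hq₁
    exact @Module.FaithfullyFlat.of_flat_of_isLocalHom _ _ _ _
      (Localization.localAlgHom p q _ hq₁).toRingHom.toAlgebra _ _ hfl hloc
  have := mem_range_of_faithfullyFlat (R := Localization.AtPrime p) (K := FractionRing A) hff
    (locToFrac_injective k q) (j := (fracLeft k A).toRingHom)
    (congrArg AlgHom.toRingHom (locToFrac_comp_localAlgHom _ includeLeft_inj p q hq₁)).symm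
    (x := θ' c) ⟨θ c, congr(($hcomp).hom c).symm⟩
  exact this

theorem extendsAlong_locToFrac [UniversallyClosed Q.hom] [IsNoetherianRing A]
    [IsNoetherianRing (A ⊗[k] A)] (h : IsTorsor ρ) {n : ℕ}
    (g : MvPolynomial (Fin n) k →ₐ[k] A) (hg : g.toRingHom.Etale)
    (φ : specOver k (FractionRing A) ⟶ Q) (p : Ideal A) [p.IsPrime] :
    ExtendsAlong (locToFrac k p) φ := by
  obtain ⟨m, hm⟩ : ∃ m : ℕ, p.height = m := ENat.ne_top_iff_exists.mp
    (Ideal.height_ne_top ‹p.IsPrime›.ne_top) |>.imp fun _ ↦ Eq.symm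
  induction m using Nat.strong_induction_on generalizing p with
  | _ m ih =>
  obtain ⟨π, y, hπ, hπp, hyp, hπy⟩ | hv := exists_prime_or_valuationRing g hg p
  · refine .of_diffFrac h p (.diffFrac_of_forall_lt h g hg p hπ hπp hyp hπy fun q _ hqp ↦ ?_)
    have hlt : q.height < p.height := Ideal.height_strict_mono_of_isPrime hqp
    obtain ⟨m', hm'⟩ : ∃ m : ℕ, q.height = m := ENat.ne_top_iff_exists.mp
      (Ideal.height_ne_top ‹q.IsPrime›.ne_top) |>.imp fun _ ↦ Eq.symm
    exact ih m' (by rw [hm, hm'] at hlt; exact_mod_cast hlt) q hm'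
  · refine .of_valuationRing _ ?_ φ
    let := (locToFrac k p).toRingHom.toAlgebra
    have : IsScalarTower A (Localization.AtPrime p) (FractionRing A) :=
      .of_algebraMap_eq fun a ↦ (locToFrac_algebraMap k p a).symm
    exact IsFractionRing.isFractionRing_of_isDomain_of_isLocalization p.primeCompl _ _

end LocalExtension

/-! ### Weil's extension theorem on a smooth variety. -/

section GlobalExtension

open scoped TensorProduct

variable {k : Type u} [Field k]

theorem exists_isAffineOpen_etale (X : Over (Spec (.of k))) [Smooth X.hom] (x : X.left) :
    ∃ (V : X.left.Opens) (hV : IsAffineOpen V), x ∈ V ∧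
      ∃ (n : ℕ) (g : MvPolynomial (Fin n) k →+* Γ(X.left, V)), g.Etale ∧
        Spec.map (CommRingCat.ofHom (g.comp MvPolynomial.C)) = hV.fromSpec ≫ X.hom := by
  obtain ⟨U, hU, V, hV, hxV, e, hs⟩ := Smooth.exists_isStandardSmooth X.hom x
  have hUtop : U = ⊤ := by
    rw [eq_top_iff]
    intro z _
    have : Subsingleton (Spec (.of k)) := inferInstanceAs (Subsingleton (PrimeSpectrum k))
    exact Subsingleton.elim (X.hom x) z ▸ e hxV
  subst hUtop
  have : IsIso hU.fromSpec := by
    have : Epi hU.fromSpec.base := by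
      rw [TopCat.epi_iff_surjective, ← Set.range_eq_univ]
      exact hU.range_fromSpec
    exact IsOpenImmersion.isIso hU.fromSpec
  obtain ⟨t, ht⟩ := Spec.map_surjective hU.fromSpec
  have : IsIso t := by
    have : IsIso (Spec.map t) := ht ▸ inferInstance
    have : IsIso (Scheme.Spec.map t.op) := this
    have := isIso_of_reflects_iso t.op Scheme.Spec
    exact isIso_of_op t
  have hs' : (t ≫ X.hom.appLE ⊤ V e).hom.IsStandardSmooth := by
    have := RingHom.isStandardSmooth_respectsIso.2 _ (asIso t).commRingCatIsoToRingEquiv hs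
    exact this
  obtain ⟨n, g, hg, hget⟩ := hs'.exists_etale_mvPolynomial
  refine ⟨V, hV, hxV, n, g, hget, ?_⟩
  rw [hg, CommRingCat.ofHom_hom, Spec.map_comp, ht, IsAffineOpen.SpecMap_appLE_fromSpec]

/-- `Spec (A ⊗ A)` is a nonempty open subscheme of `X × X`, which is integral because `X` is
geometrically integral. -/
theorem isDomain_tensorProduct (X : Over (Spec (.of k))) [IsVariety X] [Smooth X.hom]
    {A : Type u} [CommRing A] [Algebra k A] [Nontrivial A] (i : specOver k A ⟶ X)
    [IsOpenImmersion i.left] : IsDomain (A ⊗[k] A) := by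
  have := IsVariety.geometricallyIntegral (X := X)
  have := IsVariety.isIntegral X
  have : IsLocallyNoetherian X.left := LocallyOfFiniteType.isLocallyNoetherian X.hom
  have hXX : IsIntegral (Limits.pullback X.hom X.hom) := inferInstance
  let s := Spec.map (CommRingCat.ofHom (algebraMap k A))
  have hi : i.left ≫ X.hom = s := Over.w i
  let j : Limits.pullback s s ⟶ Limits.pullback X.hom X.hom :=
    Limits.pullback.map _ _ _ _ i.left i.left (𝟙 _) (by rw [hi]; simp [s]) (by rw [hi]; simp [s])
  have : IsOpenImmersion j := inferInstance
  let j' : Spec (.of (A ⊗[k] A)) ⟶ Limits.pullback X.hom X.hom :=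
    (pullbackSpecIso k A A).inv ≫ j
  have : Nontrivial (A ⊗[k] A) := inferInstance
  have : Nonempty (Spec (.of (A ⊗[k] A))) := inferInstanceAs (Nonempty (PrimeSpectrum _))
  have : IsIntegral (Spec (.of (A ⊗[k] A))) := isIntegral_of_isOpenImmersion j'
  exact affine_isIntegral_iff _ |>.mp this

theorem specMap_stalkSpecializes_fromSpecStalkOfMem {X Q : Scheme.{u}} (f : X.PartialMap Q)
    {x y : X} (h : x ⤳ y) (hx : x ∈ f.domain) (hy : y ∈ f.domain) :
    Spec.map (X.presheaf.stalkSpecializes h) ≫ f.fromSpecStalkOfMem hy =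
      f.fromSpecStalkOfMem hx := by
  rw [Scheme.PartialMap.fromSpecStalkOfMem, Scheme.PartialMap.fromSpecStalkOfMem,
    ← Category.assoc]
  congr 1
  rw [← cancel_mono f.domain.ι, Category.assoc, Scheme.Opens.fromSpecStalkOfMem_ι,
    Scheme.Opens.fromSpecStalkOfMem_ι, Scheme.SpecMap_stalkSpecializes_fromSpecStalk]

variable {X Q B : Over (Spec (.of k))} [GrpObj B] {ρ : B ⊗ Q ⟶ Q}

theorem exists_specMap_stalkSpecializes_eq [IsVariety X] [Smooth X.hom] [IsIntegral X.left]
    [UniversallyClosed Q.hom]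
    (h : IsTorsor ρ) (φ : Spec X.left.functionField ⟶ Q.left)
    (hφ : φ ≫ Q.hom = X.left.fromSpecStalk _ ≫ X.hom) (x : X.left) :
    ∃ χ : Spec (X.left.presheaf.stalk x) ⟶ Q.left,
      χ ≫ Q.hom = X.left.fromSpecStalk x ≫ X.hom ∧
      Spec.map (X.left.presheaf.stalkSpecializes (genericPoint_specializes x)) ≫ χ = φ := by
  obtain ⟨V, hV, hx, n, g, hg, hgV⟩ := exists_isAffineOpen_etale X x
  let A := Γ(X.left, V)
  let : Algebra k A := (g.comp MvPolynomial.C).toAlgebra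
  let g' : MvPolynomial (Fin n) k →ₐ[k] A := { g with commutes' := fun _ ↦ rfl }
  have : Nonempty V := ⟨⟨x, hx⟩⟩
  let i : specOver k A ⟶ X := Over.homMk hV.fromSpec hgV.symm
  have : IsOpenImmersion i.left := inferInstanceAs (IsOpenImmersion hV.fromSpec)
  have : IsDomain (A ⊗[k] A) := isDomain_tensorProduct X i
  have hft : Algebra.FiniteType k A := by
    algebraize [g]
    have : IsScalarTower k (MvPolynomial (Fin n) k) A := .of_algebraMap_eq fun _ ↦ rfl
    exact Algebra.FiniteType.trans (S := MvPolynomial (Fin n) k) inferInstance inferInstance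
  have : IsNoetherianRing A := Algebra.FiniteType.isNoetherianRing k A
  have : IsNoetherianRing (A ⊗[k] A) := Algebra.FiniteType.isNoetherianRing A _
  let p := (hV.primeIdealOf ⟨x, hx⟩).asIdeal
  have hη : genericPoint X.left ∈ V := (genericPoint_specializes x).mem_open V.2 hx
  let : Algebra A (X.left.presheaf.stalk x) := (X.left.presheaf.germ V x hx).hom.toAlgebra
  have hloc : IsLocalization.AtPrime (X.left.presheaf.stalk x) p :=
    hV.isLocalization_stalk ⟨x, hx⟩
  have hfr : IsFractionRing A X.left.functionField :=
    functionField_isFractionRing_of_isAffineOpen X.left V hV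
  obtain ⟨e, e', hee', he, he'⟩ : ∃ (e : CommRingCat.of (FractionRing A) ⟶ X.left.functionField)
      (e' : X.left.functionField ⟶ .of (FractionRing A)), e' ≫ e = 𝟙 _ ∧
      (∀ a, e (algebraMap A _ a) = X.left.presheaf.germ V _ hη a) ∧
      (X.left.presheaf.germ V _ hη ≫ e' = CommRingCat.ofHom (algebraMap A (FractionRing A))) := by
    let e : FractionRing A ≃ₐ[A] X.left.functionField := FractionRing.algEquiv A _
    exact ⟨CommRingCat.ofHom e.toRingEquiv.toRingHom, CommRingCat.ofHom e.symm.toRingEquiv.toRingHom,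
      CommRingCat.hom_ext (RingHom.ext e.apply_symm_apply), e.commutes,
      CommRingCat.hom_ext (RingHom.ext e.symm.commutes)⟩
  obtain ⟨d, hd⟩ : ∃ d : CommRingCat.of (Localization.AtPrime p) ⟶ X.left.presheaf.stalk x,
      ∀ a, d (algebraMap A _ a) = X.left.presheaf.germ V x hx a := by
    let d : Localization.AtPrime p ≃ₐ[A] X.left.presheaf.stalk x :=
      IsLocalization.algEquiv p.primeCompl _ _
    exact ⟨CommRingCat.ofHom d.toRingEquiv.toRingHom, d.commutes⟩
  have hstalk (y : X.left) (hy : y ∈ V) : X.left.fromSpecStalk y ≫ X.hom =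
      Spec.map (CommRingCat.ofHom (algebraMap k A) ≫ X.left.presheaf.germ V y hy) := by
    rw [← hV.fromSpecStalk_eq_fromSpecStalk hy, IsAffineOpen.fromSpecStalk, Category.assoc,
      ← hgV, ← Spec.map_comp]
  let φ' : specOver k (FractionRing A) ⟶ Q := Over.homMk (Spec.map e' ≫ φ) (by
    rw [Category.assoc, hφ, hstalk _ hη, ← Spec.map_comp, Category.assoc]
    exact congrArg (fun f ↦ Spec.map (CommRingCat.ofHom (algebraMap k A) ≫ f)) he')
  obtain ⟨χ, hχ⟩ := extendsAlong_locToFrac h g' hg φ' p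
  have hcomp : CommRingCat.ofHom (locToFrac k p).toRingHom ≫ e =
      d ≫ X.left.presheaf.stalkSpecializes (genericPoint_specializes x) := by
    refine CommRingCat.hom_ext (IsLocalization.ringHom_ext p.primeCompl (RingHom.ext fun a ↦ ?_))
    have h3 := congr(($(X.left.presheaf.germ_stalkSpecializes hx (genericPoint_specializes x))) a)
    exact (congrArg e (locToFrac_algebraMap k p a)).trans ((he a).trans (h3.symm.trans
      (congrArg (X.left.presheaf.stalkSpecializes (genericPoint_specializes x)) (hd a).symm)))
  refine ⟨Spec.map d ≫ χ.left, ?_, ?_⟩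
  · rw [Category.assoc, Over.w χ, hstalk x hx]
    refine (Spec.map_comp _ _).symm.trans (congrArg Spec.map ?_)
    ext a
    exact hd (algebraMap k A a)
  · have h1 : Spec.map (CommRingCat.ofHom (locToFrac k p).toRingHom) ≫ χ.left =
        Spec.map e' ≫ φ := congr(($hχ).left)
    rw [← Category.assoc, ← Spec.map_comp, ← hcomp, Spec.map_comp, Category.assoc, h1,
      ← Category.assoc, ← Spec.map_comp, hee', Spec.map_id, Category.id_comp]

theorem isDominant_fromSpecStalk_genericPoint (X : Scheme.{u}) [IrreducibleSpace X] :
    IsDominant (X.fromSpecStalk (genericPoint X)) := by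
  refine ⟨fun z ↦ ?_⟩
  refine closure_mono ?_ ((genericPoint_specializes z).mem_closure)
  rintro _ rfl
  exact ⟨_, X.fromSpecStalk_closedPoint⟩

/-- Weil's extension theorem: a rational map from a smooth variety to a torsor under an
abelian variety is a morphism. -/
theorem exists_fromSpecStalk_comp_eq [IsVariety X] [Smooth X.hom] [IsIntegral X.left]
    [UniversallyClosed Q.hom] [IsSeparated Q.hom] [LocallyOfFiniteType Q.hom]
    (h : IsTorsor ρ) (φ : Spec X.left.functionField ⟶ Q.left)
    (hφ : φ ≫ Q.hom = X.left.fromSpecStalk _ ≫ X.hom) :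
    ∃ Φ : X ⟶ Q, X.left.fromSpecStalk (genericPoint X.left) ≫ Φ.left = φ := by
  have hsep : Q.left.IsSeparated := by
    rw [Scheme.isSeparated_iff, ← Limits.terminal.comp_from Q.hom]
    infer_instance
  let r := Scheme.RationalMap.ofFunctionField X.hom Q.hom φ hφ
  have hr : r.fromFunctionField = φ := Scheme.RationalMap.fromFunctionField_ofFunctionField _ _ _ _
  have hdom : r.domain = ⊤ := by
    rw [eq_top_iff]
    intro x _
    -- An extension to the local ring at `x` spreads out to a neighbourhood, `Q` being locally of
    -- finite type, and represents the same rational map.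
    obtain ⟨χ, hχ, hχ'⟩ := exists_specMap_stalkSpecializes_eq h φ hφ x
    let f := Scheme.PartialMap.ofFromSpecStalk X.hom Q.hom χ hχ
    have hx : x ∈ f.domain := Scheme.PartialMap.mem_domain_ofFromSpecStalk X.hom Q.hom χ hχ
    refine Scheme.RationalMap.mem_domain.mpr ⟨f, hx, ?_⟩
    refine Scheme.RationalMap.eq_of_fromFunctionField_eq _ _ (.trans ?_ hr.symm)
    rw [Scheme.RationalMap.fromFunctionField_toRationalMap, Scheme.PartialMap.fromFunctionField,
      ← specMap_stalkSpecializes_fromSpecStalkOfMem f (genericPoint_specializes x) _ hx, ← hχ']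
    congr 1
    exact Scheme.PartialMap.fromSpecStalkOfMem_ofFromSpecStalk X.hom Q.hom χ hχ
  let f := r.toPartialMap
  have hfdom : f.domain = ⊤ := hdom
  let Φ : X.left ⟶ Q.left := X.left.topIso.inv ≫ (X.left.isoOfEq hfdom).inv ≫ f.hom
  have hΦ : X.left.fromSpecStalk (genericPoint X.left) ≫ Φ = φ := by
    rw [← hr, ← r.toRationalMap_toPartialMap, Scheme.RationalMap.fromFunctionField_toRationalMap]
    rw [Scheme.PartialMap.fromFunctionField, Scheme.PartialMap.fromSpecStalkOfMem]
    simp only [Φ, ← Category.assoc]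
    congr 1
    rw [← cancel_mono f.domain.ι, Scheme.Opens.fromSpecStalkOfMem_ι]
    simp
  have := isDominant_fromSpecStalk_genericPoint X.left
  refine ⟨Over.homMk Φ ?_, hΦ⟩
  refine ext_of_isDominant (X.left.fromSpecStalk (genericPoint X.left)) ?_
  rw [← Category.assoc, hΦ, hφ]

end GlobalExtension

/-! ### Geometry and base change of torsors. -/

section TorsorProperties

variable {k : Type u} [Field k]

section

variable {B Q : Over (Spec (.of k))} [GrpObj B] {ρ : B ⊗ Q ⟶ Q}

/-- The torsor isomorphism identifies this projection with `B × Q ⟶ Q`, a base change of `B ⟶ Spec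
k`. -/
theorem IsTorsor.isProper_snd [hB : IsAbelianVariety B] (h : IsTorsor ρ) :
    IsProper (Limits.pullback.snd Q.hom Q.hom) := by
  have := h.isIso
  have := hB.isProper
  have h1 : inv (lift ρ (snd B Q)) ≫ snd B Q = snd Q Q := by
    rw [IsIso.inv_comp_eq, lift_snd]
  have : IsIso (inv (lift ρ (snd B Q))).left :=
    inferInstanceAs (IsIso ((Over.forget _).map (inv (lift ρ (snd B Q)))))
  have h2 : IsProper (snd B Q).left := inferInstanceAs (IsProper (Limits.pullback.snd B.hom Q.hom))
  have h3 : IsProper (snd Q Q).left := by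
    rw [← h1, Over.comp_left]
    infer_instance
  exact h3

/-- The diagonal is a section of the separated second projection, hence a closed immersion. -/
theorem IsTorsor.isSeparated [IsAbelianVariety B] (h : IsTorsor ρ) : IsSeparated Q.hom := by
  have := h.isProper_snd
  refine ⟨?_⟩
  have : IsClosedImmersion (Limits.pullback.diagonal Q.hom ≫ Limits.pullback.snd Q.hom Q.hom) := by
    rw [Limits.pullback.diagonal_snd]
    infer_instance
  exact .of_comp _ (Limits.pullback.snd Q.hom Q.hom)

/-- Descent along `Q ⟶ Spec k`, which trivializes the torsor; a nonempty affine open `W` replaces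
`Q` to make the cover quasi-compact. -/
theorem IsTorsor.of_descendsAlong (h : IsTorsor ρ) (P : MorphismProperty Scheme.{u})
    [P.IsStableUnderBaseChange] [P.DescendsAlong (@Surjective ⊓ @Flat ⊓ @QuasiCompact)]
    (hP : P (Limits.pullback.snd Q.hom Q.hom)) : P Q.hom := by
  obtain ⟨q⟩ := h.nonempty
  obtain ⟨W, hW, hq, -⟩ := exists_isAffineOpen_mem_and_subset
    (X := Q.left) (x := q) (U := ⊤) trivial
  have : IsAffine W := hW
  have : Nonempty W := ⟨⟨q, hq⟩⟩
  have : Subsingleton (Spec (.of k)) := inferInstanceAs (Subsingleton (PrimeSpectrum k))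
  have hsq := (IsPullback.of_hasPullback (Limits.pullback.snd Q.hom Q.hom) W.ι).paste_horiz
    (IsPullback.of_hasPullback Q.hom Q.hom)
  have hsurj : Surjective (W.ι ≫ Q.hom) := ⟨Function.surjective_to_subsingleton (α := W)
    (β := Spec (.of k)) _⟩
  have hflat : Flat (W.ι ≫ Q.hom) := inferInstance
  have hqc : QuasiCompact (W.ι ≫ Q.hom) := inferInstance
  exact MorphismProperty.of_isPullback_of_descendsAlong (P := P) hsq.flip
    (Q := @Surjective ⊓ @Flat ⊓ @QuasiCompact) ⟨⟨hsurj, hflat⟩, hqc⟩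
    (P.pullback_snd _ _ hP)

theorem IsTorsor.universallyClosed [IsAbelianVariety B] (h : IsTorsor ρ) :
    UniversallyClosed Q.hom :=
  have := h.isProper_snd
  h.of_descendsAlong @UniversallyClosed inferInstance

theorem IsTorsor.locallyOfFiniteType [IsAbelianVariety B] (h : IsTorsor ρ) :
    LocallyOfFiniteType Q.hom :=
  have := h.isProper_snd
  h.of_descendsAlong @LocallyOfFiniteType inferInstance

/-- For trivial `B` the second projection of `Q × Q` is an isomorphism, so the two projections
agree; every pair of points comes from a point of `Q × Q`. -/
theorem IsTorsor.subsingleton_of_isIso (h : IsTorsor ρ) [IsIso B.hom] : Subsingleton Q.left := by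
  have := h.isIso
  have h1 : inv (lift ρ (snd B Q)) ≫ snd B Q = snd Q Q := by
    rw [IsIso.inv_comp_eq, lift_snd]
  have : IsIso (inv (lift ρ (snd B Q))).left :=
    inferInstanceAs (IsIso ((Over.forget _).map (inv (lift ρ (snd B Q)))))
  have h2 : IsIso (snd B Q).left := inferInstanceAs (IsIso (Limits.pullback.snd B.hom Q.hom))
  have h3 : IsIso (snd Q Q).left := by
    rw [← h1, Over.comp_left]
    infer_instance
  have h3' : IsIso (Limits.pullback.snd Q.hom Q.hom) := h3
  have h4 : Limits.pullback.fst Q.hom Q.hom = Limits.pullback.snd Q.hom Q.hom := by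
    have : IsIso (Limits.pullback.diagonal Q.hom) := by
      have : IsIso (Limits.pullback.diagonal Q.hom ≫ Limits.pullback.snd Q.hom Q.hom) := by
        rw [Limits.pullback.diagonal_snd]
        infer_instance
      exact IsIso.of_isIso_comp_right _ (Limits.pullback.snd Q.hom Q.hom)
    rw [← cancel_epi (Limits.pullback.diagonal Q.hom), Limits.pullback.diagonal_fst,
      Limits.pullback.diagonal_snd]
  have : Subsingleton (Spec (.of k)) := inferInstanceAs (Subsingleton (PrimeSpectrum k))
  refine ⟨fun p q ↦ ?_⟩
  obtain ⟨z, hz, hz'⟩ := Scheme.Pullback.exists_preimage_pullback (f := Q.hom) (g := Q.hom) p q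
    (Subsingleton.elim _ _)
  rw [← hz, ← hz', h4]

end

section BaseChange

variable {K : Type u} [Field K] (c : Spec (.of K) ⟶ Spec (.of k))

attribute [local instance] CategoryTheory.Functor.grpObjObj

variable {B Q : Over (Spec (.of k))} [GrpObj B] {ρ : B ⊗ Q ⟶ Q}

open Functor.LaxMonoidal in
theorem IsTorsor.baseChange (h : IsTorsor ρ) : IsTorsor
    (Functor.LaxMonoidal.μ (Over.pullback c) B Q ≫ (Over.pullback c).map ρ) where
  one_act := by
    rw [Functor.obj.η_def, comp_whiskerRight, Category.assoc, μ_natural_left_assoc,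
      ← Functor.map_comp, h.one_act, left_unitality]
  mul_act := by
    rw [Functor.obj.μ_def, comp_whiskerRight, Category.assoc, μ_natural_left_assoc,
      ← Functor.map_comp, h.mul_act, whiskerLeft_comp, Category.assoc, μ_natural_right_assoc]
    rw [Functor.map_comp, Functor.map_comp, associativity_assoc]
  isIso := by
    have := h.isIso
    have h1 : lift (Functor.LaxMonoidal.μ (Over.pullback c) B Q ≫ (Over.pullback c).map ρ) (snd _ _) ≫
        Functor.LaxMonoidal.μ (Over.pullback c) Q Q =
        Functor.LaxMonoidal.μ (Over.pullback c) B Q ≫ (Over.pullback c).map (lift ρ (snd B Q)) := by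
      rw [← Functor.Monoidal.μ_snd, ← comp_lift, Category.assoc, Functor.Monoidal.lift_μ]
    have : IsIso (lift (Functor.LaxMonoidal.μ (Over.pullback c) B Q ≫ (Over.pullback c).map ρ) (snd _ _) ≫
        Functor.LaxMonoidal.μ (Over.pullback c) Q Q) := by
      rw [h1]
      infer_instance
    exact IsIso.of_isIso_comp_right _ (Functor.LaxMonoidal.μ (Over.pullback c) Q Q)
  nonempty := by
    obtain ⟨q⟩ := h.nonempty
    have : Subsingleton (Spec (.of k)) := inferInstanceAs (Subsingleton (PrimeSpectrum k))
    obtain ⟨t⟩ : Nonempty (Spec (.of K)) := inferInstanceAs (Nonempty (PrimeSpectrum K))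
    obtain ⟨z, -⟩ := Scheme.Pullback.exists_preimage_pullback (f := Q.hom) (g := c) q t
      (Subsingleton.elim _ _)
    exact ⟨z⟩

theorem IsAbelianVariety.baseChange [hB : IsAbelianVariety B] :
    IsAbelianVariety ((Over.pullback c).obj B) where
  isProper :=
    have := hB.isProper
    inferInstanceAs (IsProper (Limits.pullback.snd B.hom c))
  smooth :=
    have := hB.smooth
    inferInstanceAs (Smooth (Limits.pullback.snd B.hom c))
  geometricallyIntegral :=
    have := hB.geometricallyIntegral
    inferInstanceAs (GeometricallyIntegral (Limits.pullback.snd B.hom c))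

end BaseChange

end TorsorProperties

/-! ### Constancy of maps from proper geometrically integral schemes to affine opens. -/

section Rigidity

open scoped TensorProduct

/-- A domain finite over a field is a field, so multiplication `E ⊗ E → E` is injective and the
degree `d` satisfies `d ^ 2 ≤ d`. -/
theorem bijective_algebraMap_of_isDomain_tensorProduct {L E : Type*} [Field L] [Field E]
    [Algebra L E] [Module.Finite L E] [IsDomain (E ⊗[L] E)] :
    Function.Bijective (algebraMap L E) := by
  have hf : IsField (E ⊗[L] E) := isField_of_isIntegral_of_isField' (Field.toIsField L)
  let := hf.toField
  have hinj : Function.Injective (Algebra.TensorProduct.lmul' (S := E) L) :=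
    (Algebra.TensorProduct.lmul' (S := E) L).toRingHom.injective
  have hle := LinearMap.finrank_le_finrank_of_injective
    (f := (Algebra.TensorProduct.lmul' (S := E) L).toLinearMap) hinj
  rw [Module.finrank_tensorProduct] at hle
  have hpos : 0 < Module.finrank L E := Module.finrank_pos
  exact Algebra.finrank_eq_one_iff_bijective_algebraMap.mp (by nlinarith)

theorem isDomain_tensorProduct_of_isIntegral {L : Type u} [Field L] {F : Scheme.{u}}
    (s : F ⟶ Spec (.of L)) [GeometricallyIntegral s] {E R : Type u} [Field E] [Algebra L E]
    [CommRing R] [Nontrivial R] [Algebra L R] (i : Spec (.of R) ⟶ F) [IsOpenImmersion i]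
    (hi : i ≫ s = Spec.map (CommRingCat.ofHom (algebraMap L R))) : IsDomain (R ⊗[L] E) := by
  let e := Spec.map (CommRingCat.ofHom (algebraMap L E))
  have hint : IsIntegral (Limits.pullback s e) :=
    GeometricallyIntegral.geometrically_isIntegral (f := s) e _ _ (.of_hasPullback _ _)
  let r := Spec.map (CommRingCat.ofHom (algebraMap L R))
  let j : Limits.pullback r e ⟶ Limits.pullback s e :=
    Limits.pullback.map _ _ _ _ i (𝟙 _) (𝟙 _) (by rw [hi]; simp [r]) (by simp)
  have : IsOpenImmersion j := inferInstance
  let j' : Spec (.of (R ⊗[L] E)) ⟶ Limits.pullback s e := (pullbackSpecIso L R E).inv ≫ j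
  have : Nonempty (Spec (.of (R ⊗[L] E))) := inferInstanceAs (Nonempty (PrimeSpectrum _))
  have : IsIntegral (Spec (.of (R ⊗[L] E))) := isIntegral_of_isOpenImmersion j'
  exact affine_isIntegral_iff _ |>.mp this

theorem toSpecΓ_specMap_appTop {F : Scheme.{u}} {R : CommRingCat.{u}} (s : F ⟶ Spec R) :
    F.toSpecΓ ≫ Spec.map ((Scheme.ΓSpecIso R).inv ≫ s.appTop) = s := by
  rw [Spec.map_comp, ← Category.assoc, ← Scheme.toSpecΓ_naturality, Category.assoc,
    toSpecΓ_SpecMap_ΓSpecIso_inv, Category.comp_id]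

/-- The global functions on a proper geometrically integral scheme over a field are constant. -/
theorem bijective_appTop_of_geometricallyIntegral {L : Type u} [Field L] {F : Scheme.{u}}
    (s : F ⟶ Spec (.of L)) [IsProper s] [GeometricallyIntegral s] :
    Function.Bijective ((Scheme.ΓSpecIso (.of L)).inv ≫ s.appTop) := by
  have hF : IsIntegral F :=
    have : Subsingleton (Spec (.of L)) := inferInstanceAs (Subsingleton (PrimeSpectrum L))
    GeometricallyIntegral.isIntegral_of_subsingleton s
  let E := Γ(F, ⊤)
  let : Field E := (isField_of_universallyClosed L s).toField
  let : Algebra L E := ((Scheme.ΓSpecIso (.of L)).inv ≫ s.appTop).hom.toAlgebra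
  have hfin : Module.Finite L E := by
    have h1 := finite_appTop_of_universallyClosed L s
    have h2 : ((Scheme.ΓSpecIso (.of L)).inv).hom.Finite :=
      RingHom.Finite.of_surjective _ (ConcreteCategory.bijective_of_isIso _).2
    exact h1.comp h2
  obtain ⟨y⟩ : Nonempty F := inferInstance
  obtain ⟨W, hW, hy, -⟩ := exists_isAffineOpen_mem_and_subset (x := y) (U := ⊤) trivial
  have : Nonempty W := ⟨⟨y, hy⟩⟩
  let R := Γ(F, W)
  let τ : E →+* R := (F.presheaf.map (homOfLE le_top).op).hom
  let : Algebra L R := (τ.comp (algebraMap L E)).toAlgebra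
  let τ' : E →ₐ[L] R := { τ with commutes' := fun _ ↦ rfl }
  have hi : hW.fromSpec ≫ s = Spec.map (CommRingCat.ofHom (algebraMap L R)) := by
    conv_lhs => rw [← toSpecΓ_specMap_appTop s]
    rw [← Category.assoc, hW.fromSpec_toSpecΓ, ← Spec.map_comp]
    rfl
  have hdom : IsDomain (R ⊗[L] E) := isDomain_tensorProduct_of_isIntegral s hW.fromSpec hi
  -- `E ⊗ E` embeds in `R ⊗ E`, a domain by geometric integrality applied to the field extension `E`
  -- of `L`.
  have hdomE : IsDomain (E ⊗[L] E) := by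
    have hinj : Function.Injective (Algebra.TensorProduct.map τ' (AlgHom.id L E)) :=
      Module.Flat.rTensor_preserves_injective_linearMap (M := E) τ'.toLinearMap τ.injective
    exact hinj.isDomain (Algebra.TensorProduct.map τ' (AlgHom.id L E)).toRingHom
  exact bijective_algebraMap_of_isDomain_tensorProduct (L := L) (E := E)

theorem exists_specMap_fromSpec_of_range_subset {L : Type u} [Field L] {F Q : Scheme.{u}}
    (s : F ⟶ Spec (.of L)) [IsProper s] [GeometricallyIntegral s] (g : F ⟶ Q)
    {V : Q.Opens} (hV : IsAffineOpen V) (h : ∀ y, g y ∈ V) :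
    ∃ φ : Spec (.of L) ⟶ Q, s ≫ φ = g := by
  have hr : Set.range g ⊆ Set.range hV.fromSpec := by
    rw [hV.range_fromSpec]
    rintro _ ⟨y, rfl⟩
    exact h y
  let t := IsOpenImmersion.lift hV.fromSpec g hr
  obtain ⟨σ, hσ, hs⟩ : ∃ σ : .of L ⟶ Γ(F, ⊤), IsIso σ ∧ F.toSpecΓ ≫ Spec.map σ = s :=
    ⟨_, (ConcreteCategory.isIso_iff_bijective _).mpr (bijective_appTop_of_geometricallyIntegral s),
      toSpecΓ_specMap_appTop s⟩
  obtain ⟨θ, hθ⟩ : ∃ θ : Γ(Q, V) ⟶ Γ(F, ⊤), F.toSpecΓ ≫ Spec.map θ = t :=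
    ⟨_, toSpecΓ_specMap_appTop t⟩
  refine ⟨Spec.map (θ ≫ inv σ) ≫ hV.fromSpec, ?_⟩
  rw [← IsOpenImmersion.lift_fac hV.fromSpec g hr]
  change _ = t ≫ _
  rw [← hθ, ← hs, Spec.map_comp]
  simp only [Category.assoc]
  rw [← Category.assoc (Spec.map σ), ← Spec.map_comp, IsIso.inv_hom_id, Spec.map_id,
    Category.id_comp]

end Rigidity

/-! ### Factoring morphisms to torsors through a standard fibration. -/

section Fibration

variable {k : Type u} [Field k]

theorem HasTrivialAlbanese.apply_eq {X B Q : Over (Spec (.of k))} [GrpObj B] [IsAbelianVariety B]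
    (hX : HasTrivialAlbanese X) {ρ : B ⊗ Q ⟶ Q} (h : IsTorsor ρ) (g : X ⟶ Q) (y y' : X.left) :
    g.left y = g.left y' := by
  obtain ⟨A, P, _, σ, a, ha, hA⟩ := hX
  obtain ⟨t, rfl, -⟩ := ha.existsUnique_fac B Q ρ h g
  have := ha.isTorsor.subsingleton_of_isIso
  change t.left (a.left y) = t.left (a.left y')
  rw [Subsingleton.elim (a.left y) (a.left y')]

attribute [local instance] CategoryTheory.Functor.grpObjObj

variable {Y X B Q : Over (Spec (.of k))} [GrpObj B] [IsAbelianVariety B] {ρ : B ⊗ Q ⟶ Q}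

/-- The torsor is base changed to `κ(x)`, so that `g` on the fibre becomes a `κ(x)`-morphism to a
torsor under an abelian variety over `κ(x)`. -/
theorem apply_eq_of_hasTrivialAlbanese_fibre (f : Y ⟶ X) (x : X.left)
    (hx : HasTrivialAlbanese (fibre f.left x)) (h : IsTorsor ρ) (g : Y ⟶ Q) (y y' : Y.left)
    (hy : f.left y = x) (hy' : f.left y' = x) : g.left y = g.left y' := by
  let c : Spec (.of (X.left.residueField x)) ⟶ Spec (.of k) :=
    X.left.fromSpecResidueField x ≫ X.hom
  have := IsAbelianVariety.baseChange c (B := B)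
  have hw : (f.left.fiberι x ≫ g.left) ≫ Q.hom = f.left.fiberToSpecResidueField x ≫ c := by
    rw [Category.assoc, Over.w g, ← Over.w f, ← Category.assoc,
      Scheme.Hom.fiber_fac, Category.assoc]
  let g' : fibre f.left x ⟶ (Over.pullback c).obj Q :=
    Over.homMk (Limits.pullback.lift _ _ hw) (Limits.pullback.lift_snd _ _ _)
  have hg' : g'.left ≫ Limits.pullback.fst Q.hom c = f.left.fiberι x ≫ g.left :=
    Limits.pullback.lift_fst _ _ _
  have key (z z') := hx.apply_eq (h.baseChange c) g' z z'
  have key' (z z' : f.left.fiber x) : g.left (f.left.fiberι x z) = g.left (f.left.fiberι x z') := by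
    have h1 (z : f.left.fiber x) :
        Limits.pullback.fst Q.hom c (g'.left z) = g.left (f.left.fiberι x z) := congr($hg' z)
    exact (h1 z).symm.trans ((congrArg _ (key z z')).trans (h1 z'))
  have hmem (y : Y.left) (hy : f.left y = x) : y ∈ Set.range (f.left.fiberι x) := by
    rw [f.left.range_fiberι]
    exact hy
  obtain ⟨z, rfl⟩ := hmem y hy
  obtain ⟨z', rfl⟩ := hmem y' hy'
  exact key' z z'

theorem apply_genericPoint_of_isDominant {Y X : Scheme.{u}} [IrreducibleSpace Y]
    [IrreducibleSpace X] (f : Y ⟶ X) [IsDominant f] : f (genericPoint Y) = genericPoint X := by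
  apply IsGenericPoint.eq _ (genericPoint_spec X)
  have := (genericPoint_spec Y).image f.continuous
  rw [Set.image_univ] at this
  rwa [f.denseRange.closure_range] at this

/-- If a morphism from `Y` to a torsor under an abelian variety is constant on some fibre of a
standard fibration `f` over a smooth base, then it factors through `f`. -/
theorem IsStandardFibration.exists_comp_eq {f : Y ⟶ X} (hf : IsStandardFibration f)
    [Smooth X.hom] (h : IsTorsor ρ) (g : Y ⟶ Q) (x : X.left)
    (hx : ∀ y y', f.left y = x → f.left y' = x → g.left y = g.left y') :
    ∃ Φ : X ⟶ Q, f ≫ Φ = g := by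
  have := hf.isVariety_source
  have := hf.isVariety_target
  have := hf.isDominant
  have := hf.isProper
  have := IsVariety.isIntegral X
  have := IsVariety.isIntegral Y
  have := h.universallyClosed
  have := h.isSeparated
  have := h.locallyOfFiniteType
  set ξ := genericPoint X.left with hξ
  have hgi := hf.geometricallyIntegral_generic ξ (genericPoint_spec _)
  have hsurj : Function.Surjective f.left := by
    rw [← Set.range_eq_univ, ← f.left.isClosedMap.isClosed_range.closure_eq]
    exact f.left.denseRange.closure_range
  obtain ⟨y₀, hy₀⟩ := hsurj x
  obtain ⟨V, hV, hyV, -⟩ := exists_isAffineOpen_mem_and_subset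
    (X := Q.left) (x := g.left y₀) (U := ⊤) trivial
  -- `Set.kernImage` consists of the points whose whole fibre goes into `V`.
  have hopen : IsOpen (Set.kernImage f.left (g.left ⁻¹ᵁ V : Set Y.left)) :=
    isClosedMap_iff_kernImage.mp f.left.isClosedMap (g.left ⁻¹ᵁ V).2
  have hmem : x ∈ Set.kernImage f.left (g.left ⁻¹ᵁ V : Set Y.left) := fun y hy ↦
    (hx y y₀ hy hy₀ ▸ hyV : g.left y ∈ V)
  have hξV : ξ ∈ Set.kernImage f.left (g.left ⁻¹ᵁ V : Set Y.left) :=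
    (genericPoint_specializes x).mem_open hopen hmem
  have hprop : IsProper (f.left.fiberToSpecResidueField ξ) :=
    inferInstanceAs (IsProper (Limits.pullback.snd f.left _))
  obtain ⟨φ₀, hφ₀⟩ := exists_specMap_fromSpec_of_range_subset
    (L := X.left.residueField ξ) (f.left.fiberToSpecResidueField ξ) (f.left.fiberι ξ ≫ g.left) hV
    fun z ↦ hξV (by
      have : f.left.fiberι ξ z ∈ f.left ⁻¹' {ξ} := f.left.range_fiberι ξ ▸ ⟨z, rfl⟩
      exact this)
  have hflat : Flat (f.left.fiberToSpecResidueField ξ) := by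
    have : IsIntegral (Spec (X.left.residueField ξ)) :=
      inferInstanceAs (IsIntegral (Spec (.of (X.left.residueField ξ))))
    infer_instance
  have hepi : Epi (f.left.fiberToSpecResidueField ξ) :=
    Flat.epi_of_flat_of_surjective _
  have hφ₀over : φ₀ ≫ Q.hom = X.left.fromSpecResidueField ξ ≫ X.hom := by
    rw [← cancel_epi (f.left.fiberToSpecResidueField ξ), ← Category.assoc, hφ₀, Category.assoc,
      Over.w g, ← Over.w f, ← Category.assoc, Scheme.Hom.fiber_fac,
      Category.assoc]
  -- The local ring at the generic point is a field, hence equal to its residue field.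
  have hres : IsIso (X.left.residue ξ) := by
    rw [ConcreteCategory.isIso_iff_bijective]
    refine ⟨?_, X.left.residue_surjective ξ⟩
    exact (X.left.residue ξ).hom.injective
  let φ := inv (Spec.map (X.left.residue ξ)) ≫ φ₀
  obtain ⟨Φ, hΦ⟩ := exists_fromSpecStalk_comp_eq (X := X) h φ (by
    rw [Category.assoc, hφ₀over, IsIso.inv_comp_eq]
    rfl)
  refine ⟨Φ, ?_⟩
  have hι : IsDominant (f.left.fiberι ξ) := by
    refine ⟨fun z ↦ ?_⟩
    refine closure_mono ?_ ((genericPoint_specializes z).mem_closure)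
    rw [f.left.range_fiberι, Set.singleton_subset_iff]
    exact apply_genericPoint_of_isDominant f.left
  ext1
  refine ext_of_isDominant_of_isSeparated Q.hom (by rw [Over.w, Over.w]) (f.left.fiberι ξ) ?_
  rw [← hφ₀, Over.comp_left, ← Category.assoc, Scheme.Hom.fiber_fac,
    Category.assoc]
  congr 1
  rw [Scheme.fromSpecResidueField, Category.assoc, hΦ, IsIso.hom_inv_id_assoc]

end Fibration

end Alb

theorem mainTheorem7 {k : Type u} [Field k] [PerfectField k] {X Y : Over (Spec (.of k))}
    (f : Y ⟶ X) (hf : Alb.IsStandardFibration f) (hXsmooth : Smooth X.hom)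
    (hX : Alb.HasTrivialAlbanese X)
    (hfibre : ∃ x : X.left, Smooth (Alb.fibre f.left x).hom ∧
      Alb.HasTrivialAlbanese (Alb.fibre f.left x)) :
    Alb.HasTrivialAlbanese Y := by
  obtain ⟨x, -, hx⟩ := hfibre
  obtain ⟨A, P, hGrp, ρ, a, ha, hA⟩ := hX
  refine ⟨A, P, hGrp, ρ, f ≫ a, ⟨ha.isAbelianVariety, ha.isTorsor, fun B Q _ _ σ hσ g ↦ ?_⟩, hA⟩
  obtain ⟨Φ, rfl⟩ := hf.exists_comp_eq hσ g x fun y y' ↦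
    Alb.apply_eq_of_hasTrivialAlbanese_fibre f x hx hσ g y y'
  obtain ⟨h, rfl, huniq⟩ := ha.existsUnique_fac B Q σ hσ Φ
  refine ⟨h, Category.assoc _ _ _, fun h' hh' ↦ huniq h' ?_⟩
  have := hf.isVariety_target
  have := hf.isDominant
  have := Alb.IsVariety.isIntegral X
  have := hσ.isSeparated
  ext1
  refine ext_of_isDominant_of_isSeparated Q.hom (by rw [Over.w, Over.w]) f.left ?_
  have := congr(($hh').left)
  rwa [Over.comp_left, Over.comp_left, Category.assoc, ← Over.comp_left] at this
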